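/- **Setting.** An instance $I$ of prize-collecting Steiner forest consists of a finite graph $G=(V,E)$ with edge costs $c_e\ge 0$, finitely many pairs $(s_i,t_i)$ of distinct vertices, and penalties $\pi_i\ge 0$. A solution is a forest $F\subseteq E$; the pair $i$ is *separated* by $F$ if $s_i,t_i$ lie in different components of $(V,F)$, and the cost of $F$ is $\sum_{e\in F}c_e+\sum_{i\text{ separated by }F}\pi_i$. A solution of minimum cost is optimal. **Algorithm Primal-Dual Forest** (with penalties $\pi_i$). It keeps a forest $F$, initially empty, whose components (vertex sets) are labelled active or inactive. For each set $S$ that has been a component it keeps a growth $y(S)$, a number $\mathrm{Uncharged}(S)$ (both initially $0$) and a number $\mathrm{Potential}(S)$. Each $s_i$ and each $t_i$ is a terminal (several terminals may sit at one vertex), labelled alive (initially), satisfied or dead. The initially active components are the singletons of terminals, and each terminal of the pair $i$ contributes $\pi_i/2$ to the potential of its singleton; the other singletons are inactive with potential $0$. While there is an active component, all active components $S$ grow simultaneously by the same amount $\varDelta\ge0$ (that is, $y(S)$ and $\mathrm{Uncharged}(S)$ increase and $\mathrm{Potential}(S)$ decreases by $\varDelta$) until one of the following events occurs; ties are broken arbitrarily.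 1. An edge $e$ joining two components $S_1\ne S_2$, at least one of them active, becomes tight: $\sum_{S:\,e\in\delta(S)}y(S)=c_e$. Then $e$ is added to $F$. The new component $S=S_1\cup S_2$ is active, with $y(S)=\mathrm{Uncharged}(S)=0$ and $\mathrm{Potential}(S)=\mathrm{Potential}(S_1)+\mathrm{Potential}(S_2)$. For each pair $i$ with one terminal in $S_1$ and the other in $S_2$, in any order: for each of $s_i$, $t_i$ that is alive, the value returned by ProcessHistory of this terminal is subtracted from $\mathrm{Potential}(S)$; then both are marked satisfied if both were alive, and both are marked dead otherwise. 2. An active component $S$ has potential $0$. Then $S$ becomes inactive, and each alive terminal in $S$, in any order, is marked dead and its history is processed. ProcessHistory of a terminal of the pair $i$: start with $r=\pi_i/2$ and go, in increasing order of size, through the components formed so far that contain the terminal and after whose formation it was alive. At such a component $S$: if $\mathrm{Uncharged}(S)\le r$, set $y_{i,S}=\mathrm{Uncharged}(S)$, decrease $r$ by this amount and set $\mathrm{Uncharged}(S)=0$; otherwise set $y_{i,S}=r$, decrease $\mathrm{Uncharged}(S)$ by $r$, and stop, returning $0$. If all components have been visited, return $r$. Finally (deletion phase), go through the edges $e$ of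 $F$ in any order and delete $e$ unless $F-e$ separates a pair whose two terminals are both satisfied. The output is the resulting $F$. **Theorem.** Let $0<\varepsilon\le1$, let $F^*$ be any optimal solution of $I$, and let $\mathrm{OPT}=\sum_{e\in F^*}c_e+\sum_{i\text{ separated by }F^*}\pi_i$. Let $I'$ be the instance obtained from $I$ by replacing each penalty $\pi_i$ by $\pi_i'=2\pi_i/\varepsilon$. Then Primal-Dual Forest on $I'$ can be run to termination, and every output $F'$ that it can produce on $I'$ is a forest in $G$ with $$\sum_{e\in F'}c_e\le\frac{8\,\mathrm{OPT}}{\varepsilon}\qquad\text{and}\qquad\sum_{i\in X}\pi_i\le\varepsilon\,\mathrm{OPT},$$ where $X$ is the set of indices $i$ of the pairs that are separated by $F'$ but not by $F^*$. -/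

import Mathlib

open scoped Classical

noncomputable section

/-- An instance of the prize-collecting Steiner forest problem on a finite graph: edge costs,
vertex pairs `(s i, t i)`, and a penalty for leaving each pair disconnected. -/
structure PCSF (V ι : Type*) where
  graph : SimpleGraph V
  cost : Sym2 V → ℝ
  s : ι → V
  t : ι → V
  penalty : ι → ℝ
  cost_nonneg : ∀ e ∈ graph.edgeSet, 0 ≤ cost e
  penalty_nonneg : ∀ i, 0 ≤ penalty i
  s_ne_t : ∀ i, s i ≠ t i

/-- The label of a terminal during the algorithm. -/
inductive TerminalLabel where
  | alive
  | satisfied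
  | dead

/-- The state of the primal-dual algorithm. The terminal `s i` is written `(i, true)` and the
terminal `t i` is written `(i, false)`; labels and histories belong to terminals, so that several
terminals may sit at one vertex. -/
structure PDState (V ι : Type*) where
  /-- the edges selected so far -/
  forest : Finset (Sym2 V)
  /-- the active components; all other connected components of `forest` are inactive -/
  active : Finset (Finset V)
  /-- the growth `y(S)` -/
  y : Finset V → ℝ
  /-- `Potential(S)` -/
  potential : Finset V → ℝ
  /-- `Uncharged(S)` -/
  uncharged : Finset V → ℝ
  /-- the dual variables `y_{i,S}` -/
  charge : ι → Finset V → ℝ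
  label : ι × Bool → TerminalLabel
  /-- `History(τ)`: the components that contain `τ` and after whose formation `τ` was alive, in
  the order in which they were formed. They are nested, so this is the order of increasing size. -/
  history : ι × Bool → List (Finset V)

namespace PCSF

variable {V ι : Type*}

/-- The vertices `s i` and `t i` lie in different components of the graph with edge set `F`. -/
def Separated (I : PCSF V ι) (F : Finset (Sym2 V)) (i : ι) : Prop :=
  ¬ (SimpleGraph.fromEdgeSet (F : Set (Sym2 V))).Reachable (I.s i) (I.t i)

/-- The feasible solutions: forests in the graph. -/
def IsForest (I : PCSF V ι) (F : Finset (Sym2 V)) : Prop :=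
  (F : Set (Sym2 V)) ⊆ I.graph.edgeSet ∧
    (SimpleGraph.fromEdgeSet (F : Set (Sym2 V))).IsAcyclic

/-- The total edge cost of `F`. -/
def length (I : PCSF V ι) (F : Finset (Sym2 V)) : ℝ := ∑ e ∈ F, I.cost e

/-- The edge cost of `F` plus the penalties of the pairs separated by `F`. -/
def totalCost [Fintype ι] (I : PCSF V ι) (F : Finset (Sym2 V)) : ℝ :=
  I.length F + ∑ i with I.Separated F i, I.penalty i

/-- `F` is an optimal solution. -/
def IsOptimal [Fintype ι] (I : PCSF V ι) (F : Finset (Sym2 V)) : Prop :=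
  I.IsForest F ∧ ∀ F', I.IsForest F' → I.totalCost F ≤ I.totalCost F'

/-- The instance with the same graph and edge costs and with penalties `2 π_i / ε`. -/
def scaled (I : PCSF V ι) (ε : ℝ) (hε : 0 < ε) : PCSF V ι where
  graph := I.graph
  cost := I.cost
  s := I.s
  t := I.t
  penalty i := 2 * I.penalty i / ε
  cost_nonneg := I.cost_nonneg
  penalty_nonneg i := div_nonneg (mul_nonneg zero_le_two (I.penalty_nonneg i)) hε.le
  s_ne_t := I.s_ne_t

/-- The vertex of a terminal. -/
def vertex (I : PCSF V ι) (τ : ι × Bool) : V := if τ.2 then I.s τ.1 else I.t τ.1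

/-- The list `l` enumerates the elements that satisfy `p`, each once, in some order. -/
def Enumerates {α : Type*} (l : List α) (p : α → Prop) : Prop :=
  l.Nodup ∧ ∀ a, a ∈ l ↔ p a

/-- The edge `e` has exactly one endpoint in `S`, that is, `e ∈ δ(S)`. -/
def Crosses (e : Sym2 V) (S : Finset V) : Prop :=
  ∃ u v, e = s(u, v) ∧ u ∈ S ∧ v ∉ S

/-- The vertex set of the connected component of `v` in the graph with edge set `F`. -/
def component [Fintype V] (F : Finset (Sym2 V)) (v : V) : Finset V :=
  {w | (SimpleGraph.fromEdgeSet (F : Set (Sym2 V))).Reachable v w}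

/-- The initial state. The active components are the singletons of terminals, and every terminal
contributes half of the penalty of its pair to the potential of its singleton. -/
def initState [Fintype ι] (I : PCSF V ι) : PDState V ι where
  forest := ∅
  active := Finset.univ.image fun τ : ι × Bool => {I.vertex τ}
  y _ := 0
  potential S := ∑ τ : ι × Bool with S = {I.vertex τ}, I.penalty τ.1 / 2
  uncharged _ := 0
  charge _ _ := 0
  label _ := .alive
  history τ := [{I.vertex τ}]

/-- Every active component grows by `Δ`. -/
def grow (st : PDState V ι) (Δ : ℝ) : PDState V ι :=
  { st with
    y := fun S => if S ∈ st.active then st.y S + Δ else st.y S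
    potential := fun S => if S ∈ st.active then st.potential S - Δ else st.potential S
    uncharged := fun S => if S ∈ st.active then st.uncharged S + Δ else st.uncharged S }

/-- The sum of `y(S)` over the sets `S` with `e ∈ δ(S)`. -/
def load [Fintype V] (st : PDState V ι) (e : Sym2 V) : ℝ :=
  ∑ S : Finset V with Crosses e S, st.y S

/-- All active components can grow by `Δ` without exceeding their potentials or the cost of an
edge. -/
def CanGrow [Fintype V] (I : PCSF V ι) (st : PDState V ι) (Δ : ℝ) : Prop :=
  0 ≤ Δ ∧ (∀ S ∈ st.active, Δ ≤ st.potential S) ∧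
    ∀ e ∈ I.graph.edgeSet, load (grow st Δ) e ≤ I.cost e

/-- The loop of `ProcessHistory` for a terminal of the pair `i`. The arguments are the components
still to be visited, `RemainingCharge`, and the variables `Uncharged` and `y_{i,S}`; the result
consists of the returned number and the new values of these variables. -/
def processLoop (i : ι) : List (Finset V) → ℝ → (Finset V → ℝ) → (ι → Finset V → ℝ) →
    ℝ × (Finset V → ℝ) × (ι → Finset V → ℝ)
  | [], r, u, c => (r, u, c)
  | S :: L, r, u, c =>
    if u S ≤ r then
      processLoop i L (r - u S) (Function.update u S 0)
        (Function.update c i (Function.update (c i) S (u S)))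
    else
      (0, Function.update u S (u S - r), Function.update c i (Function.update (c i) S r))

/-- `ProcessHistory(τ)`: the returned number and the new state. -/
def processHistory (I : PCSF V ι) (st : PDState V ι) (τ : ι × Bool) : ℝ × PDState V ι :=
  let p := processLoop τ.1 (st.history τ) (I.penalty τ.1 / 2) st.uncharged st.charge
  (p.1, { st with uncharged := p.2.1, charge := p.2.2 })

/-- If `τ` is alive, process its history and subtract the returned number from the potential
of `S`. -/
def settle (I : PCSF V ι) (S : Finset V) (st : PDState V ι) (τ : ι × Bool) : PDState V ι :=
  if st.label τ = .alive then
    let p := I.processHistory st τ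
    { p.2 with potential := Function.update p.2.potential S (p.2.potential S - p.1) }
  else st

/-- The treatment of a pair `i` that is united by the new component `S`. -/
def unite (I : PCSF V ι) (S : Finset V) (st : PDState V ι) (i : ι) : PDState V ι :=
  let st' := I.settle S (I.settle S st (i, true)) (i, false)
  let lab : TerminalLabel :=
    if st.label (i, true) = .alive ∧ st.label (i, false) = .alive then .satisfied else .dead
  { st' with label := Function.update (Function.update st'.label (i, true) lab) (i, false) lab }

/-- The new component formed from `S₁` and `S₂` unites the pair `i`: it contains both terminals of
the pair, and neither `S₁` nor `S₂` does. -/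
def Unites (I : PCSF V ι) (S₁ S₂ : Finset V) (i : ι) : Prop :=
  (I.s i ∈ S₁ ∧ I.t i ∈ S₂) ∨ (I.s i ∈ S₂ ∧ I.t i ∈ S₁)

/-- Add the edge `e` joining the components `S₁` and `S₂`, where `l` lists the united pairs in the
order in which they are treated. -/
def merge (I : PCSF V ι) (st : PDState V ι) (e : Sym2 V) (S₁ S₂ : Finset V) (l : List ι) :
    PDState V ι :=
  let S := S₁ ∪ S₂
  let st₁ : PDState V ι :=
    { st with
      forest := insert e st.forest
      active := insert S (st.active \ {S₁, S₂})
      y := Function.update st.y S 0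
      uncharged := Function.update st.uncharged S 0
      potential := Function.update st.potential S (st.potential S₁ + st.potential S₂) }
  let st₂ := l.foldl (I.unite S) st₁
  { st₂ with
    history := fun τ =>
      if I.vertex τ ∈ S ∧ st₂.label τ = .alive then st₂.history τ ++ [S] else st₂.history τ }

/-- Mark the terminal `τ` as dead and process its history. -/
def kill (I : PCSF V ι) (st : PDState V ι) (τ : ι × Bool) : PDState V ι :=
  (I.processHistory { st with label := Function.update st.label τ .dead } τ).2

/-- Mark the component `S` as inactive, where `l` lists the alive terminals in `S` in the order in
which they are treated. -/
def deactivate (I : PCSF V ι) (st : PDState V ι) (S : Finset V) (l : List (ι × Bool)) :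
    PDState V ι :=
  l.foldl I.kill { st with active := st.active.erase S }

/-- One iteration of the main loop: the active components grow until an edge between two
components, at least one of them active, goes tight and is then added, or until an active component
has used all its potential and is then marked inactive. Simultaneous events are treated one after
the other (with growth `0` in between) in an arbitrary order. -/
inductive Step [Fintype V] (I : PCSF V ι) : PDState V ι → PDState V ι → Prop
  | addEdge (st : PDState V ι) (Δ : ℝ) (hΔ : I.CanGrow st Δ) (u v : V) (huv : I.graph.Adj u v)
      (hne : component st.forest u ≠ component st.forest v)
      (hact : component st.forest u ∈ st.active ∨ component st.forest v ∈ st.active)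
      (htight : load (grow st Δ) s(u, v) = I.cost s(u, v))
      (l : List ι)
      (hl : Enumerates l (I.Unites (component st.forest u) (component st.forest v))) :
      Step I st
        (I.merge (grow st Δ) s(u, v) (component st.forest u) (component st.forest v) l)
  | exhaust (st : PDState V ι) (Δ : ℝ) (hΔ : I.CanGrow st Δ) (S : Finset V) (hS : S ∈ st.active)
      (hpot : (grow st Δ).potential S = 0)
      (l : List (ι × Bool))
      (hl : Enumerates l (fun τ => I.vertex τ ∈ S ∧ st.label τ = .alive)) :
      Step I st (I.deactivate (grow st Δ) S l)

/-- One step of the deletion phase: delete `e` unless this separates a satisfied pair. -/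
def deleteEdge (I : PCSF V ι) (st : PDState V ι) (F : Finset (Sym2 V)) (e : Sym2 V) :
    Finset (Sym2 V) :=
  if ∃ i, st.label (i, true) = .satisfied ∧ st.label (i, false) = .satisfied ∧
      I.Separated (F.erase e) i then F
  else F.erase e

/-- `F` is an output of the algorithm `Primal-Dual Forest` on the instance `I` (there may be
several, because ties and the order of the inner loops are left open). -/
def PrimalDualForestOutput [Fintype V] [Fintype ι] (I : PCSF V ι) (F : Finset (Sym2 V)) : Prop :=
  ∃ (st : PDState V ι) (l : List (Sym2 V)),
    Relation.ReflTransGen I.Step I.initState st ∧ st.active = ∅ ∧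
    Enumerates l (· ∈ st.forest) ∧ F = l.foldl (I.deleteEdge st) st.forest

end PCSF

end

noncomputable section

namespace PCSF

variable {V ι : Type*}

/-! ### Reachability and components -/

/-! The charges give a dual solution `z i = ∑ S, y_{i,S}` with four properties, collected in
`PrimalDualForestOutput.exists_dual`: the output costs at most `2 * ∑ i, z i`; each `z i` is at most
the penalty used in the run; it is at least half of that penalty if the output separates the pair;
and the pairs connected by an edge set together pay at most its cost. With penalties `2 π_i / ε` the
theorem follows. A pair in `X` has `π_i ≤ ε z_i`, and `X` is connected by the optimum, so its
penalties sum to at most `ε` times the edge cost of the optimum. The output costs at most twice the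
edge cost of the optimum plus twice the scaled penalties that the optimum pays.

The factor `2` in the cost is the usual primal-dual degree argument: at any time an inactive
component is not a leaf of the final forest after contracting components (`Inv.cutDegree_ne_one`),
so active components have average degree at most `2` (`sum_cutDegree_le`).

The properties of `z` rest on `Ledger`, kept throughout the run. The potential of a component plus
the uncharged growth inside it equals half the penalties of its alive terminals. Moreover, a
Hall-type condition holds: for every `T` inside a component, the alive terminals in `T` can afford
all uncharged growth inside `T`. Hence potentials stay nonnegative, and once no terminal is alive
nothing is uncharged. A terminal killed at potential `0` must pay its full half penalty, since
otherwise the potential would become negative. Finally, a pair only charges sets that contain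
exactly one of its terminals, and any edge set connecting the pair crosses such sets, which gives
weak duality. -/

/-- Two vertices are connected by a path with edges in `F`. -/
abbrev Joined (F : Finset (Sym2 V)) (a b : V) : Prop :=
  (SimpleGraph.fromEdgeSet (F : Set (Sym2 V))).Reachable a b

theorem Joined.mono {F F' : Finset (Sym2 V)} (h : F ⊆ F') {a b : V} (hab : Joined F a b) :
    Joined F' a b :=
  SimpleGraph.Reachable.mono (SimpleGraph.fromEdgeSet_mono (by exact_mod_cast h)) hab

theorem joined_of_mem {F : Finset (Sym2 V)} {a b : V} (h : s(a, b) ∈ F) : Joined F a b := by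
  by_cases hab : a = b
  · subst hab; exact SimpleGraph.Reachable.refl _
  · exact SimpleGraph.Adj.reachable (by simp [SimpleGraph.fromEdgeSet_adj, h, hab])

theorem joined_induction {F : Finset (Sym2 V)} {P : V → Prop}
    (h : ∀ a b, s(a, b) ∈ F → P a → P b) {a b : V} (hab : Joined F a b) (ha : P a) : P b := by
  obtain ⟨p⟩ := hab
  induction p with
  | nil => exact ha
  | cons hadj p ih =>
    exact ih (h _ _ (by simpa using (SimpleGraph.fromEdgeSet_adj _).1 hadj |>.1) ha)

theorem crosses_mk {u v : V} {S : Finset V} :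
    Crosses s(u, v) S ↔ (u ∈ S ∧ v ∉ S) ∨ (v ∈ S ∧ u ∉ S) := by
  constructor
  · rintro ⟨a, b, hab, ha, hb⟩
    rcases Sym2.eq_iff.1 hab with ⟨rfl, rfl⟩ | ⟨rfl, rfl⟩
    · exact .inl ⟨ha, hb⟩
    · exact .inr ⟨ha, hb⟩
  · rintro (⟨ha, hb⟩ | ⟨ha, hb⟩)
    · exact ⟨u, v, rfl, ha, hb⟩
    · exact ⟨v, u, Sym2.eq_swap, ha, hb⟩

theorem mem_iff_of_joined {F : Finset (Sym2 V)} {S : Finset V} (h : ∀ e ∈ F, ¬ Crosses e S)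
    {a b : V} (hab : Joined F a b) : a ∈ S ↔ b ∈ S := by
  have key : ∀ {a b : V}, Joined F a b → a ∈ S → b ∈ S := fun hab =>
    joined_induction (fun a b he ha => by
      by_contra hb
      exact h _ he ⟨a, b, rfl, ha, hb⟩) hab
  exact ⟨key hab, key hab.symm⟩

theorem exists_crosses_of_joined {F : Finset (Sym2 V)} {S : Finset V} {a b : V}
    (hab : Joined F a b) (ha : a ∈ S) (hb : b ∉ S) : ∃ e ∈ F, Crosses e S := by
  by_contra! h
  exact hb ((mem_iff_of_joined h hab).1 ha)

theorem joined_insert {F : Finset (Sym2 V)} {u v a b : V} :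
    Joined (insert s(u, v) F) a b ↔
      Joined F a b ∨ (Joined F a u ∧ Joined F v b) ∨ (Joined F a v ∧ Joined F u b) := by
  constructor
  · intro h
    refine joined_induction (P := fun b => Joined F a b ∨ (Joined F a u ∧ Joined F v b) ∨
      (Joined F a v ∧ Joined F u b)) ?_ h (.inl (.refl a))
    intro c d hcd hc
    rcases Finset.mem_insert.1 hcd with hcd | hcd
    · rcases Sym2.eq_iff.1 hcd with ⟨rfl, rfl⟩ | ⟨rfl, rfl⟩
      · rcases hc with hc | hc | hc
        · exact .inr (.inl ⟨hc, .refl _⟩)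
        · exact .inr (.inl ⟨hc.1, .refl _⟩)
        · exact .inl hc.1
      · rcases hc with hc | hc | hc
        · exact .inr (.inr ⟨hc, .refl _⟩)
        · exact .inl hc.1
        · exact .inr (.inr ⟨hc.1, .refl _⟩)
    · have := joined_of_mem hcd
      rcases hc with hc | hc | hc
      · exact .inl (hc.trans this)
      · exact .inr (.inl ⟨hc.1, hc.2.trans this⟩)
      · exact .inr (.inr ⟨hc.1, hc.2.trans this⟩)
  · have hs : F ⊆ insert s(u, v) F := Finset.subset_insert _ _
    have huv : Joined (insert s(u, v) F) u v := joined_of_mem (Finset.mem_insert_self _ _)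
    rintro (h | h | h)
    · exact h.mono hs
    · exact (h.1.mono hs).trans (huv.trans (h.2.mono hs))
    · exact (h.1.mono hs).trans (huv.symm.trans (h.2.mono hs))

theorem fromEdgeSet_insert (F : Finset (Sym2 V)) (u v : V) :
    SimpleGraph.fromEdgeSet ((insert s(u, v) F : Finset (Sym2 V)) : Set (Sym2 V)) =
      SimpleGraph.fromEdgeSet (F : Set (Sym2 V)) ⊔ SimpleGraph.edge u v := by
  rw [Finset.coe_insert, Set.insert_eq, Set.union_comm, SimpleGraph.edge,
    ← SimpleGraph.fromEdgeSet_union]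

theorem not_joined_of_isAcyclic_insert {F : Finset (Sym2 V)} {u v : V} (huv : u ≠ v)
    (he : s(u, v) ∉ F)
    (h : (SimpleGraph.fromEdgeSet ((insert s(u, v) F : Finset (Sym2 V)) : Set (Sym2 V))).IsAcyclic) :
    ¬ Joined F u v := by
  rw [fromEdgeSet_insert, SimpleGraph.isAcyclic_sup_fromEdgeSet_iff] at h
  intro hj
  rcases h.2 hj with h | h
  · exact huv h
  · exact he (by simpa using ((SimpleGraph.fromEdgeSet_adj _).1 h).1)

section Components

variable [Fintype V]

theorem mem_component {F : Finset (Sym2 V)} {v w : V} : w ∈ component F v ↔ Joined F v w := by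
  simp [component]

theorem self_mem_component (F : Finset (Sym2 V)) (v : V) : v ∈ component F v :=
  mem_component.2 (.refl v)

theorem component_eq_iff {F : Finset (Sym2 V)} {v w : V} :
    component F v = component F w ↔ Joined F v w := by
  constructor
  · intro h
    exact mem_component.1 (h ▸ self_mem_component F w)
  · intro h
    ext x
    simp only [mem_component]
    exact ⟨fun h' => h.symm.trans h', fun h' => h.trans h'⟩

theorem component_eq_of_mem {F : Finset (Sym2 V)} {v w : V} (h : w ∈ component F v) :
    component F w = component F v :=
  (component_eq_iff.2 (mem_component.1 h)).symm

theorem component_mono {F F' : Finset (Sym2 V)} (h : F ⊆ F') (v : V) :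
    component F v ⊆ component F' v := fun _ hw => mem_component.2 ((mem_component.1 hw).mono h)

theorem component_empty (v : V) : component (∅ : Finset (Sym2 V)) v = {v} := by
  ext w
  rw [mem_component, Finset.mem_singleton]
  constructor
  · intro h
    exact joined_induction (P := fun x => x = v) (by simp) h rfl
  · rintro rfl; exact .refl _

theorem not_crosses_component {F : Finset (Sym2 V)} {e : Sym2 V} (he : e ∈ F) (v : V) :
    ¬ Crosses e (component F v) := by
  rintro ⟨a, b, rfl, ha, hb⟩
  exact hb (mem_component.2 ((mem_component.1 ha).trans (joined_of_mem he)))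

theorem component_insert_of_mem {F : Finset (Sym2 V)} {u v w : V}
    (h : w ∈ component F u ∪ component F v) :
    component (insert s(u, v) F) w = component F u ∪ component F v := by
  ext x
  simp only [Finset.mem_union, mem_component, joined_insert] at h ⊢
  rcases h with h | h
  · constructor
    · rintro (h' | h' | h')
      · exact .inl (h.trans h')
      · exact .inr h'.2
      · exact .inl h'.2
    · rintro (h' | h')
      · exact .inl (h.symm.trans h')
      · exact .inr (.inl ⟨h.symm, h'⟩)
  · constructor
    · rintro (h' | h' | h')
      · exact .inr (h.trans h')
      · exact .inr h'.2
      · exact .inl h'.2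
    · rintro (h' | h')
      · exact .inr (.inr ⟨h.symm, h'⟩)
      · exact .inl (h.symm.trans h')

theorem component_insert_of_notMem {F : Finset (Sym2 V)} {u v w : V}
    (h : w ∉ component F u ∪ component F v) :
    component (insert s(u, v) F) w = component F w := by
  ext x
  simp only [Finset.mem_union, mem_component, joined_insert, not_or] at h ⊢
  constructor
  · rintro (h' | h' | h')
    · exact h'
    · exact absurd h'.1.symm h.1
    · exact absurd h'.1.symm h.2
  · exact .inl

theorem component_eq_of_not_crosses {F F' : Finset (Sym2 V)} (hF : F ⊆ F') {v : V}
    (h : ∀ e ∈ F', ¬ Crosses e (component F v)) : component F' v = component F v := by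
  apply Finset.Subset.antisymm
  · intro w hw
    exact (mem_iff_of_joined h (mem_component.1 hw)).1 (self_mem_component F v)
  · exact component_mono hF v

/-! ### Counting in forests -/

/-- The vertex sets of the components of `F`. -/
def components (F : Finset (Sym2 V)) : Finset (Finset V) := Finset.univ.image (component F)

theorem component_mem_components (F : Finset (Sym2 V)) (v : V) : component F v ∈ components F :=
  Finset.mem_image_of_mem _ (Finset.mem_univ v)

theorem mem_components {F : Finset (Sym2 V)} {S : Finset V} :
    S ∈ components F ↔ ∃ v, component F v = S := by
  simp [components]

theorem components_insert (F : Finset (Sym2 V)) (u v : V) :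
    components (insert s(u, v) F) =
      insert (component F u ∪ component F v)
        (components F \ {component F u, component F v}) := by
  ext S
  simp only [mem_components, Finset.mem_insert, Finset.mem_sdiff, Finset.mem_singleton]
  constructor
  · rintro ⟨w, rfl⟩
    by_cases hw : w ∈ component F u ∪ component F v
    · exact .inl (component_insert_of_mem hw)
    · rw [component_insert_of_notMem hw]
      refine .inr ⟨⟨w, rfl⟩, ?_⟩
      rw [Finset.mem_union, not_or] at hw
      rintro (h | h)
      · exact hw.1 (h ▸ self_mem_component F w)
      · exact hw.2 (h ▸ self_mem_component F w)
  · rintro (rfl | ⟨⟨w, rfl⟩, h⟩)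
    · exact ⟨u, component_insert_of_mem (Finset.mem_union_left _ (self_mem_component F u))⟩
    · refine ⟨w, component_insert_of_notMem ?_⟩
      rw [Finset.mem_union]
      rintro (h' | h')
      · exact h (.inl (component_eq_of_mem h'))
      · exact h (.inr (component_eq_of_mem h'))

theorem card_components_insert {F : Finset (Sym2 V)} {u v : V} (h : ¬ Joined F u v) :
    (components (insert s(u, v) F)).card + 1 = (components F).card := by
  have hne : component F u ≠ component F v := fun h' => h (component_eq_iff.1 h')
  have hsub : ({component F u, component F v} : Finset (Finset V)) ⊆ components F := by
    intro S hS
    simp only [Finset.mem_insert, Finset.mem_singleton] at hS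
    rcases hS with rfl | rfl <;> exact component_mem_components _ _
  have hcard := Finset.card_sdiff_add_card_eq_card hsub
  rw [Finset.card_pair hne] at hcard
  rw [components_insert, Finset.card_insert_of_notMem]
  · omega
  · intro hmem
    obtain ⟨hS, hS'⟩ := Finset.mem_sdiff.1 hmem
    obtain ⟨w, hw⟩ := mem_components.1 hS
    have h1 : u ∈ component F w := hw ▸ Finset.mem_union_left _ (self_mem_component F u)
    have := component_eq_of_mem h1
    exact hS' (by simp [← hw, ← this])

/-- Each new edge of an acyclic set joins two different components. Loops must be excluded
separately: `fromEdgeSet` ignores them, so acyclicity does not, yet they would count in `F.card`. -/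
theorem card_components_add_card {F : Finset (Sym2 V)} (hd : ∀ e ∈ F, ¬ e.IsDiag)
    (h : (SimpleGraph.fromEdgeSet (F : Set (Sym2 V))).IsAcyclic) :
    (components F).card + F.card = Fintype.card V := by
  induction F using Finset.induction_on with
  | empty =>
    have : components (∅ : Finset (Sym2 V)) = Finset.univ.image (fun v : V => ({v} : Finset V)) := by
      rw [components, show component (∅ : Finset (Sym2 V)) = _ from funext component_empty]
    rw [this, Finset.card_image_of_injective _ Finset.singleton_injective]
    simp
  | insert e F he ih =>
    induction e using Sym2.ind with
    | _ u v =>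
    have huv : u ≠ v := by simpa using hd _ (Finset.mem_insert_self _ _)
    have hsub : F ⊆ insert s(u, v) F := Finset.subset_insert _ _
    have h1 := card_components_insert (not_joined_of_isAcyclic_insert huv he h)
    have h2 := ih (fun e he => hd e (hsub he))
      (h.anti (SimpleGraph.fromEdgeSet_mono (by exact_mod_cast hsub)))
    rw [Finset.card_insert_of_notMem he]
    omega

/-- The number of edges of `F` that leave `S`. -/
def cutDegree (F : Finset (Sym2 V)) (S : Finset V) : ℕ := (F.filter (Crosses · S)).card

/-- Double counting: an edge of `F` crosses no component of `F`, and any other edge crosses at most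
the components of its two endpoints. -/
theorem sum_cutDegree_components_le (F F' : Finset (Sym2 V)) :
    ∑ S ∈ components F, cutDegree F' S ≤ 2 * (F' \ F).card := by
  have h1 : ∑ S ∈ components F, cutDegree F' S =
      ∑ e ∈ F', ((components F).filter (Crosses e ·)).card := by
    simp only [cutDegree, Finset.card_filter]
    exact Finset.sum_comm
  rw [h1, ← Finset.sum_sdiff (Finset.inter_subset_left : F' ∩ F ⊆ F')]
  have h2 : ∑ e ∈ F' ∩ F, ((components F).filter (Crosses e ·)).card = 0 := by
    refine Finset.sum_eq_zero fun e he => ?_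
    rw [Finset.card_eq_zero, Finset.filter_eq_empty_iff]
    intro S hS
    obtain ⟨v, rfl⟩ := mem_components.1 hS
    exact not_crosses_component (Finset.mem_inter.1 he).2 v
  rw [h2, add_zero, Finset.sdiff_inter_self_left, mul_comm]
  refine Finset.sum_le_card_nsmul _ _ 2 fun e _ => ?_
  induction e using Sym2.ind with
  | _ u v =>
  refine (Finset.card_le_card (t := {component F u, component F v}) ?_).trans Finset.card_le_two
  intro S hS
  obtain ⟨hS, hc⟩ := Finset.mem_filter.1 hS
  obtain ⟨w, rfl⟩ := mem_components.1 hS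
  rw [Finset.mem_insert, Finset.mem_singleton]
  rcases crosses_mk.1 hc with hc | hc
  · exact .inl (component_eq_of_mem hc.1).symm
  · exact .inr (component_eq_of_mem hc.1).symm

/-- Adding `F'` to `F₀` lowers the number of components by exactly `(F' \ F₀).card`, because the
union is acyclic. Components of `F₀` that `F'` does not leave survive as components of the union. -/
theorem card_sdiff_le_card_components {F₀ F F' : Finset (Sym2 V)} (h₀ : F₀ ⊆ F) (h' : F' ⊆ F)
    (hd : ∀ e ∈ F, ¬ e.IsDiag)
    (hF : (SimpleGraph.fromEdgeSet (F : Set (Sym2 V))).IsAcyclic) :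
    (F' \ F₀).card ≤ ((components F₀).filter (cutDegree F' · ≠ 0)).card := by
  have hsub : F₀ ∪ F' ⊆ F := Finset.union_subset h₀ h'
  have hac : ∀ {F₁ : Finset (Sym2 V)}, F₁ ⊆ F →
      (components F₁).card + F₁.card = Fintype.card V := fun hF₁ =>
    card_components_add_card (fun e he => hd e (hF₁ he))
      (hF.anti (SimpleGraph.fromEdgeSet_mono (by exact_mod_cast hF₁)))
  have c1 := hac h₀
  have c2 := hac hsub
  have c3 : (F₀ ∪ F').card = F₀.card + (F' \ F₀).card := by
    rw [← Finset.union_sdiff_self_eq_union, Finset.card_union_of_disjoint Finset.disjoint_sdiff]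
  have c4 : ((components F₀).filter (¬ cutDegree F' · ≠ 0)).card ≤ (components (F₀ ∪ F')).card := by
    refine Finset.card_le_card fun S hS => ?_
    obtain ⟨hS, hdeg⟩ := Finset.mem_filter.1 hS
    obtain ⟨v, rfl⟩ := mem_components.1 hS
    rw [not_not, cutDegree, Finset.card_eq_zero, Finset.filter_eq_empty_iff] at hdeg
    refine mem_components.2 ⟨v, component_eq_of_not_crosses Finset.subset_union_left ?_⟩
    intro e he
    rcases Finset.mem_union.1 he with he | he
    · exact not_crosses_component he v
    · exact hdeg he
  have c5 := Finset.card_filter_add_card_filter_not (s := components F₀) (cutDegree F' · ≠ 0)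
  omega

/-- The degree argument of the primal-dual method: if the components outside `𝒜` are not leaves,
then the components in `𝒜` have average degree at most `2`. -/
theorem sum_cutDegree_le {F₀ F F' : Finset (Sym2 V)} (h₀ : F₀ ⊆ F) (h' : F' ⊆ F)
    (hd : ∀ e ∈ F, ¬ e.IsDiag)
    (hF : (SimpleGraph.fromEdgeSet (F : Set (Sym2 V))).IsAcyclic)
    {𝒜 : Finset (Finset V)} (h𝒜 : 𝒜 ⊆ components F₀)
    (hleaf : ∀ S ∈ components F₀, S ∉ 𝒜 → cutDegree F' S ≠ 1) :
    ∑ S ∈ 𝒜, cutDegree F' S ≤ 2 * 𝒜.card := by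
  have h1 := sum_cutDegree_components_le F₀ F'
  have h2 := card_sdiff_le_card_components h₀ h' hd hF
  rw [← Finset.sum_sdiff h𝒜] at h1
  -- A component outside `𝒜` that is not isolated has degree at least `2`, so its own degree
  -- accounts for its share of the bound `2 * (F' \ F₀).card`. Only the share of `𝒜` remains.
  have h3 : 2 * ((components F₀ \ 𝒜).filter (cutDegree F' · ≠ 0)).card ≤
      ∑ S ∈ components F₀ \ 𝒜, cutDegree F' S := by
    rw [← Finset.sum_filter_ne_zero, mul_comm]
    refine Finset.card_nsmul_le_sum _ _ 2 fun S hS => ?_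
    obtain ⟨hS, hne⟩ := Finset.mem_filter.1 hS
    obtain ⟨hS, hS'⟩ := Finset.mem_sdiff.1 hS
    have := hleaf S hS hS'
    omega
  have h4 : ((components F₀).filter (cutDegree F' · ≠ 0)).card ≤
      ((components F₀ \ 𝒜).filter (cutDegree F' · ≠ 0)).card + 𝒜.card := by
    refine (Finset.card_le_card (fun S hS => ?_)).trans (Finset.card_union_le _ _)
    simp only [Finset.mem_union, Finset.mem_filter, Finset.mem_sdiff] at hS ⊢
    tauto
  omega

end Components

end PCSF

namespace PCSF

variable {V ι : Type*}

/-! ### Processing a history -/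

/-- What the loop of `ProcessHistory` does to the variables `Uncharged` and `y_{i,S}` when it
visits the chain `L` with remaining charge `r`. -/
structure LoopSpec (i : ι) (L : List (Finset V)) (r : ℝ) (u : Finset V → ℝ)
    (c : ι → Finset V → ℝ) (p : ℝ × (Finset V → ℝ) × (ι → Finset V → ℝ)) : Prop where
  fst_le : p.1 ≤ r
  fst_nonneg : 0 ≤ p.1
  charge_other : ∀ j, j ≠ i → p.2.2 j = c j
  add_eq : ∀ S, p.2.1 S + p.2.2 i S = u S + c i S
  uncharged_nonneg : ∀ S, 0 ≤ p.2.1 S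
  uncharged_le : ∀ S, p.2.1 S ≤ u S
  uncharged_notMem : ∀ S, S ∉ L → p.2.1 S = u S
  sum_eq : ∀ T, (∀ S ∈ L, S ⊆ T) →
    ∑ S ∈ T.powerset, p.2.1 S = ∑ S ∈ T.powerset, u S - (r - p.1)
  sum_le_or : ∀ T, ∑ S ∈ T.powerset, p.2.1 S ≤ ∑ S ∈ T.powerset, u S - r ∨
    ∀ S ∈ L, S ⊆ T → p.2.1 S = 0

theorem sum_powerset_update {u : Finset V → ℝ} {S T : Finset V} (x : ℝ) (h : S ⊆ T) :
    ∑ R ∈ T.powerset, Function.update u S x R = ∑ R ∈ T.powerset, u R - u S + x := by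
  rw [Finset.sum_update_of_mem (Finset.mem_powerset.2 h),
    ← Finset.sum_sdiff (Finset.singleton_subset_iff.2 (Finset.mem_powerset.2 h))]
  simp
  ring

/-- Induction along the chain. The loop overwrites `y_{i,S}` instead of adding to it, so `hc` is
what makes `uncharged + charge` invariant. For `sum_le_or`, nestedness makes the members of `L`
inside `T` an initial segment: either the charge runs out within it, or all its members are emptied.
-/
theorem loopSpec_processLoop (i : ι) (L : List (Finset V)) (r : ℝ) (u : Finset V → ℝ)
    (c : ι → Finset V → ℝ) (hr : 0 ≤ r) (hu : ∀ S, 0 ≤ u S) (hL : L.Pairwise (· ⊂ ·))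
    (hc : ∀ S ∈ L, c i S = 0) : LoopSpec i L r u c (processLoop i L r u c) := by
  induction L generalizing r u c with
  | nil =>
    constructor <;> simp [processLoop, hr, hu]
  | cons S L ih =>
    obtain ⟨hS, hL⟩ := List.pairwise_cons.1 hL
    have hSL : S ∉ L := fun h => (hS S h).ne rfl
    have hcS : c i S = 0 := hc S List.mem_cons_self
    rw [processLoop]
    split_ifs with hle
    · have hne : ∀ R ∈ L, R ≠ S := fun R hR h => hSL (h ▸ hR)
      have IH := ih (r - u S) (Function.update u S 0)
        (Function.update c i (Function.update (c i) S (u S))) (by linarith)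
        (fun R => by
          by_cases h : R = S
          · subst h; simp
          · simp [h, hu R])
        hL (fun R hR => by simp [hne R hR, hc R (List.mem_cons_of_mem _ hR)])
      set p := processLoop i L (r - u S) (Function.update u S 0)
        (Function.update c i (Function.update (c i) S (u S)))
      have hpS : p.2.1 S = 0 := by simpa using IH.uncharged_notMem S hSL
      refine ⟨by linarith [IH.fst_le, hu S], IH.fst_nonneg, ?_, ?_, IH.uncharged_nonneg, ?_, ?_,
        ?_, ?_⟩
      · intro j hj
        rw [IH.charge_other j hj, Function.update_of_ne hj]
      · intro R
        rw [IH.add_eq R, Function.update_self]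
        by_cases h : R = S
        · subst h; simp [hcS]
        · simp [h]
      · intro R
        refine (IH.uncharged_le R).trans ?_
        by_cases h : R = S
        · subst h; simp [hu]
        · simp [h]
      · intro R hR
        rw [List.mem_cons, not_or] at hR
        rw [IH.uncharged_notMem R hR.2, Function.update_of_ne hR.1]
      · intro T hT
        rw [IH.sum_eq T fun R hR => hT R (List.mem_cons_of_mem _ hR),
          sum_powerset_update _ (hT S List.mem_cons_self)]
        ring
      · intro T
        by_cases hST : S ⊆ T
        · rcases IH.sum_le_or T with h | h
          · left
            rw [sum_powerset_update _ hST] at h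
            linarith
          · right
            intro R hR hRT
            rcases List.mem_cons.1 hR with rfl | hR
            · exact hpS
            · exact h R hR hRT
        -- The chain increases: if its first member is not inside `T`, no member is, and the second
        -- alternative is vacuous.
        · right
          intro R hR hRT
          rcases List.mem_cons.1 hR with rfl | hR
          · exact absurd hRT hST
          · exact absurd ((hS R hR).subset.trans hRT) hST
    · push Not at hle
      refine ⟨hr, le_rfl, ?_, ?_, ?_, ?_, ?_, ?_, ?_⟩
      · intro j hj
        simp [hj]
      · intro R
        by_cases h : R = S
        · subst h; simp [hcS]
        · simp [h]
      · intro R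
        by_cases h : R = S
        · subst h; simp [hle.le]
        · simp [h, hu R]
      · intro R
        by_cases h : R = S
        · subst h; simp [hr]
        · simp [h]
      · intro R hR
        rw [List.mem_cons, not_or] at hR
        simp [hR.1]
      · intro T hT
        simp only
        rw [sum_powerset_update _ (hT S List.mem_cons_self)]
        ring
      · intro T
        by_cases hST : S ⊆ T
        · left
          simp only
          rw [sum_powerset_update _ hST]
          linarith
        · right
          intro R hR hRT
          rcases List.mem_cons.1 hR with rfl | hR
          · exact absurd hRT hST
          · exact absurd ((hS R hR).subset.trans hRT) hST

theorem LoopSpec.charge_le {i : ι} {L : List (Finset V)} {r : ℝ} {u : Finset V → ℝ}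
    {c : ι → Finset V → ℝ} {p : ℝ × (Finset V → ℝ) × (ι → Finset V → ℝ)}
    (h : LoopSpec i L r u c p) (j : ι) (S : Finset V) : c j S ≤ p.2.2 j S := by
  by_cases hj : j = i
  · subst hj
    linarith [h.add_eq S, h.uncharged_le S]
  · rw [h.charge_other j hj]

/-- Whatever leaves `uncharged` enters the charge of `i`, and over all sets the amount is `r` minus
the returned number. -/
theorem LoopSpec.sum_charge [Fintype V] {i : ι} {L : List (Finset V)} {r : ℝ} {u : Finset V → ℝ}
    {c : ι → Finset V → ℝ} {p : ℝ × (Finset V → ℝ) × (ι → Finset V → ℝ)}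
    (h : LoopSpec i L r u c p) : ∑ S, p.2.2 i S = ∑ S, c i S + (r - p.1) := by
  have h1 : ∑ S, (p.2.1 S + p.2.2 i S) = ∑ S, (u S + c i S) :=
    Finset.sum_congr rfl fun S _ => h.add_eq S
  have h2 := h.sum_eq Finset.univ fun S _ => Finset.subset_univ S
  rw [Finset.powerset_univ] at h2
  rw [Finset.sum_add_distrib, Finset.sum_add_distrib] at h1
  linarith

/-! ### The ledger of potentials, uncharged growth and charges -/

variable [Fintype V] [Fintype ι]

/-- The relations between the growth, the potentials, the uncharged amounts and the charges in a
state of the algorithm, where `A` is the set of terminals whose history is not yet processed. -/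
structure Ledger (I : PCSF V ι) (A : Finset (ι × Bool)) (st : PDState V ι) : Prop where
  uncharged_nonneg : ∀ S, 0 ≤ st.uncharged S
  charge_nonneg : ∀ i S, 0 ≤ st.charge i S
  uncharged_supp : ∀ S, st.uncharged S ≠ 0 → ∃ v ∈ S, S ⊆ component st.forest v
  history_sorted : ∀ τ, (st.history τ).Pairwise (· ⊂ ·)
  mem_of_history : ∀ i b, ∀ S ∈ st.history (i, b), I.vertex (i, b) ∈ S ∧ I.vertex (i, !b) ∉ S ∧
    S ⊆ component st.forest (I.vertex (i, b))
  mem_history : ∀ τ ∈ A, ∀ S, I.vertex τ ∈ S → st.uncharged S ≠ 0 → S ∈ st.history τ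
  charge_supp : ∀ i S, st.charge i S ≠ 0 → ∃ b, (i, b) ∉ A ∧ S ∈ st.history (i, b)
  balance : ∀ v, st.potential (component st.forest v) +
      ∑ T ∈ (component st.forest v).powerset, st.uncharged T =
    ∑ τ ∈ A with I.vertex τ ∈ component st.forest v, I.penalty τ.1 / 2
  uncharged_sum_le : ∀ v, ∀ T ⊆ component st.forest v,
    ∑ S ∈ T.powerset, st.uncharged S ≤ ∑ τ ∈ A with I.vertex τ ∈ T, I.penalty τ.1 / 2
  charge_sum_le : ∀ i, ∑ S, st.charge i S ≤ ∑ b : Bool with (i, b) ∉ A, I.penalty i / 2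
  y_eq : ∀ S, st.y S = st.uncharged S + ∑ i, st.charge i S

/-- By `balance`, the potential of a component is the slack of `uncharged_sum_le` when `T` is the
whole component. -/
theorem Ledger.potential_nonneg {I : PCSF V ι} {A : Finset (ι × Bool)} {st : PDState V ι}
    (h : Ledger I A st) (v : V) : 0 ≤ st.potential (component st.forest v) := by
  have h1 := h.balance v
  have h2 := h.uncharged_sum_le v _ subset_rfl
  linarith

/-- An earlier charge of the pair could only come from the partner of `τ`, and the sets in the
partner's history do not contain the vertex of `τ`. This provides the hypothesis `hc` of
`loopSpec_processLoop`. -/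
theorem Ledger.charge_eq_zero {I : PCSF V ι} {A : Finset (ι × Bool)} {st : PDState V ι}
    (h : Ledger I A st) {τ : ι × Bool} (hτ : τ ∈ A) {S : Finset V} (hS : S ∈ st.history τ) :
    st.charge τ.1 S = 0 := by
  obtain ⟨i, b'⟩ := τ
  by_contra hne
  obtain ⟨b, hb, hSb⟩ := h.charge_supp _ _ hne
  have hbb : b' = !b := by
    cases b <;> cases b' <;> simp_all
  subst hbb
  exact (h.mem_of_history _ _ _ hSb).2.1 (h.mem_of_history _ _ _ hS).1

theorem Ledger.loopSpec {I : PCSF V ι} {A : Finset (ι × Bool)} {st : PDState V ι}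
    (h : Ledger I A st) {τ : ι × Bool} (hτ : τ ∈ A) :
    LoopSpec τ.1 (st.history τ) (I.penalty τ.1 / 2) st.uncharged st.charge
      (processLoop τ.1 (st.history τ) (I.penalty τ.1 / 2) st.uncharged st.charge) :=
  loopSpec_processLoop _ _ _ _ _ (div_nonneg (I.penalty_nonneg _) zero_le_two)
    h.uncharged_nonneg (h.history_sorted τ) fun _ hS => h.charge_eq_zero hτ hS

/-- Processing the history of `τ` and lowering the potential of its component by the returned
number keeps the ledger. -/
theorem Ledger.process {I : PCSF V ι} {A : Finset (ι × Bool)} {st : PDState V ι}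
    (h : Ledger I A st) {τ : ι × Bool} (hτ : τ ∈ A) {C : Finset V}
    (hC : C = component st.forest (I.vertex τ)) :
    Ledger I (A.erase τ) { (I.processHistory st τ).2 with
      potential := Function.update st.potential C
        (st.potential C - (I.processHistory st τ).1) } := by
  have sp := h.loopSpec hτ
  simp only [processHistory]
  set p := processLoop τ.1 (st.history τ) (I.penalty τ.1 / 2) st.uncharged st.charge
  have hmem : ∀ S ∈ st.history τ, I.vertex τ ∈ S ∧ S ⊆ C := fun S hS => by
    rw [hC]
    exact ⟨(h.mem_of_history τ.1 τ.2 S hS).1, (h.mem_of_history τ.1 τ.2 S hS).2.2⟩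
  have hne : ∀ {S}, p.2.1 S ≠ 0 → st.uncharged S ≠ 0 := fun {S} hS hS' =>
    hS (le_antisymm (hS' ▸ sp.uncharged_le S) (sp.uncharged_nonneg S))
  have hcov : ∀ {S}, I.vertex τ ∈ S → S ∉ st.history τ → p.2.1 S = 0 := fun {S} hS hS' => by
    by_contra hn
    exact hS' (h.mem_history τ hτ S hS (hne hn))
  have hsame : ∀ T : Finset V, I.vertex τ ∉ T →
      ∑ S ∈ T.powerset, p.2.1 S = ∑ S ∈ T.powerset, st.uncharged S := fun T hT =>
    Finset.sum_congr rfl fun S hS => sp.uncharged_notMem S fun hS' =>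
      hT (Finset.mem_powerset.1 hS (hmem S hS').1)
  have herase : ∀ T : Finset V, I.vertex τ ∉ T →
      ((A.erase τ).filter (I.vertex · ∈ T)) = A.filter (I.vertex · ∈ T) := fun T hT => by
    ext σ
    simp only [Finset.mem_filter, Finset.mem_erase]
    constructor
    · exact fun h => ⟨h.1.2, h.2⟩
    · exact fun h => ⟨⟨fun hσ => hT (hσ ▸ h.2), h.1⟩, h.2⟩
  have hsum : ∀ T : Finset V, I.vertex τ ∈ T →
      ∑ σ ∈ A.erase τ with I.vertex σ ∈ T, I.penalty σ.1 / 2 =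
        ∑ σ ∈ A with I.vertex σ ∈ T, I.penalty σ.1 / 2 - I.penalty τ.1 / 2 := fun T hT => by
    rw [Finset.filter_erase, eq_sub_iff_add_eq]
    exact Finset.sum_erase_add (f := fun σ : ι × Bool => I.penalty σ.1 / 2) _
      (Finset.mem_filter.2 ⟨hτ, hT⟩)
  constructor
  · exact sp.uncharged_nonneg
  · exact fun i S => (h.charge_nonneg i S).trans (sp.charge_le i S)
  · exact fun S hS => h.uncharged_supp S (hne hS)
  · exact h.history_sorted
  · exact h.mem_of_history
  · exact fun σ hσ S hS hS' => h.mem_history σ (Finset.mem_of_mem_erase hσ) S hS (hne hS')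
  · intro i S hS
    by_cases hcS : st.charge i S = 0
    · have hi : i = τ.1 := by
        by_contra hi
        exact hS (by simp only [sp.charge_other i hi, hcS])
      subst hi
      refine ⟨τ.2, by simp, ?_⟩
      by_contra hn
      have := sp.add_eq S
      rw [sp.uncharged_notMem S hn, hcS] at this
      exact hS (by simpa using this)
    · obtain ⟨b, hb, hS'⟩ := h.charge_supp i S hcS
      exact ⟨b, fun hb' => hb (Finset.mem_of_mem_erase hb'), hS'⟩
  · intro v
    have hb := h.balance v
    simp only
    by_cases hv : I.vertex τ ∈ component st.forest v
    · have hCv : component st.forest v = C := by rw [hC, component_eq_of_mem hv]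
      rw [hCv] at hb hv ⊢
      -- The uncharged amount inside `C` falls by the half penalty minus the returned number, and
      -- the potential falls by the returned number. Together they lose exactly the half penalty of
      -- `τ`.
      rw [hsum C hv, Function.update_self, sp.sum_eq C fun S hS => (hmem S hS).2]
      linarith
    · have hCv : component st.forest v ≠ C := fun hCv =>
        hv (hCv ▸ hC ▸ self_mem_component _ _)
      rw [herase _ hv, Function.update_of_ne hCv, hsame _ hv, hb]
  · intro v T hT
    have hh := h.uncharged_sum_le v T hT
    simp only
    by_cases hv : I.vertex τ ∈ T
    · rw [hsum T hv]
      rcases sp.sum_le_or T with hle | hz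
      · linarith
      -- Here `τ` has emptied its whole history inside `T`, so no subset of `T` containing its
      -- vertex is uncharged any more. The old bound for `T` without that vertex then suffices.
      · have hT' := h.uncharged_sum_le v (T.erase (I.vertex τ)) ((Finset.erase_subset _ _).trans hT)
        have e1 : ∑ S ∈ T.powerset, p.2.1 S =
            ∑ S ∈ (T.erase (I.vertex τ)).powerset, p.2.1 S := by
          symm
          refine Finset.sum_subset (Finset.powerset_mono.2 (Finset.erase_subset _ _)) ?_
          intro S hS hS'
          have hτS : I.vertex τ ∈ S := by
            by_contra hn
            exact hS' (Finset.mem_powerset.2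
              (Finset.subset_erase.2 ⟨Finset.mem_powerset.1 hS, hn⟩))
          by_cases hm : S ∈ st.history τ
          · exact hz S hm (Finset.mem_powerset.1 hS)
          · exact hcov hτS hm
        rw [e1, hsame _ (Finset.notMem_erase _ _), ← hsum T hv]
        refine hT'.trans (Finset.sum_le_sum_of_subset_of_nonneg ?_ fun σ _ _ =>
          div_nonneg (I.penalty_nonneg _) zero_le_two)
        intro σ hσ
        simp only [Finset.mem_filter, Finset.mem_erase] at hσ ⊢
        exact ⟨⟨fun hσ' => hσ.2.1 (hσ' ▸ rfl), hσ.1⟩, hσ.2.2⟩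
    · rw [herase _ hv, hsame _ hv]
      exact hh
  · intro i
    simp only
    by_cases hi : i = τ.1
    · subst hi
      have e : (Finset.univ.filter fun b => (τ.1, b) ∉ A.erase τ) =
          insert τ.2 (Finset.univ.filter fun b => (τ.1, b) ∉ A) := by
        ext b
        simp only [Finset.mem_filter, Finset.mem_univ, true_and, Finset.mem_insert,
          Finset.mem_erase, not_and_or, not_not, Prod.ext_iff]
      rw [e, Finset.sum_insert (by simp [hτ]), sp.sum_charge]
      linarith [h.charge_sum_le τ.1, sp.fst_nonneg]
    · have e : (Finset.univ.filter fun b => (i, b) ∉ A.erase τ) =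
          Finset.univ.filter fun b => (i, b) ∉ A := by
        ext b
        simp only [Finset.mem_filter, Finset.mem_univ, true_and, Finset.mem_erase, not_and_or,
          not_not, Prod.ext_iff, hi, false_and, false_or]
      rw [e, sp.charge_other i hi]
      exact h.charge_sum_le i
  · intro S
    simp only
    rw [h.y_eq S, ← Finset.add_sum_erase _ _ (Finset.mem_univ τ.1),
      ← Finset.add_sum_erase (a := τ.1) _ (fun i => p.2.2 i S) (Finset.mem_univ τ.1),
      ← add_assoc, ← add_assoc, sp.add_eq S]
    congr 1
    refine Finset.sum_congr rfl fun j hj => ?_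
    rw [sp.charge_other j (Finset.ne_of_mem_erase hj)]

end PCSF

namespace PCSF

variable {V ι : Type*}

/-! ### Growing and merging components -/

section Frames

variable (I : PCSF V ι) (S : Finset V) (st : PDState V ι)

theorem settle_forest (τ : ι × Bool) : (I.settle S st τ).forest = st.forest := by
  unfold settle; split_ifs <;> rfl

theorem settle_active (τ : ι × Bool) : (I.settle S st τ).active = st.active := by
  unfold settle; split_ifs <;> rfl

theorem settle_y (τ : ι × Bool) : (I.settle S st τ).y = st.y := by
  unfold settle; split_ifs <;> rfl

theorem settle_label (τ : ι × Bool) : (I.settle S st τ).label = st.label := by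
  unfold settle; split_ifs <;> rfl

theorem settle_history (τ : ι × Bool) : (I.settle S st τ).history = st.history := by
  unfold settle; split_ifs <;> rfl

theorem unite_forest (i : ι) : (I.unite S st i).forest = st.forest := by
  simp [unite, settle_forest]

theorem unite_active (i : ι) : (I.unite S st i).active = st.active := by
  simp [unite, settle_active]

theorem unite_y (i : ι) : (I.unite S st i).y = st.y := by
  simp [unite, settle_y]

theorem unite_history (i : ι) : (I.unite S st i).history = st.history := by
  simp [unite, settle_history]

theorem unite_label_of_ne {i j : ι} (h : j ≠ i) (b : Bool) :
    (I.unite S st i).label (j, b) = st.label (j, b) := by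
  simp [unite, settle_label, h]

theorem unite_label_self (i : ι) (b : Bool) :
    (I.unite S st i).label (i, b) =
      if st.label (i, true) = .alive ∧ st.label (i, false) = .alive then .satisfied
      else .dead := by
  cases b <;> simp [unite]

theorem foldl_unite_forest (l : List ι) : (l.foldl (I.unite S) st).forest = st.forest := by
  induction l generalizing st with
  | nil => rfl
  | cons i l ih => rw [List.foldl_cons, ih, unite_forest]

theorem foldl_unite_active (l : List ι) : (l.foldl (I.unite S) st).active = st.active := by
  induction l generalizing st with
  | nil => rfl
  | cons i l ih => rw [List.foldl_cons, ih, unite_active]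

theorem foldl_unite_y (l : List ι) : (l.foldl (I.unite S) st).y = st.y := by
  induction l generalizing st with
  | nil => rfl
  | cons i l ih => rw [List.foldl_cons, ih, unite_y]

theorem foldl_unite_history (l : List ι) : (l.foldl (I.unite S) st).history = st.history := by
  induction l generalizing st with
  | nil => rfl
  | cons i l ih => rw [List.foldl_cons, ih, unite_history]

theorem kill_label (τ : ι × Bool) :
    (I.kill st τ).label = Function.update st.label τ .dead := rfl

theorem foldl_kill_forest (k : List (ι × Bool)) : (k.foldl I.kill st).forest = st.forest := by
  induction k generalizing st with
  | nil => rfl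
  | cons τ k ih => rw [List.foldl_cons, ih]; rfl

theorem foldl_kill_active (k : List (ι × Bool)) : (k.foldl I.kill st).active = st.active := by
  induction k generalizing st with
  | nil => rfl
  | cons τ k ih => rw [List.foldl_cons, ih]; rfl

theorem foldl_kill_y (k : List (ι × Bool)) : (k.foldl I.kill st).y = st.y := by
  induction k generalizing st with
  | nil => rfl
  | cons τ k ih => rw [List.foldl_cons, ih]; rfl

end Frames

theorem sum_filter_vertex_union (I : PCSF V ι) (A : Finset (ι × Bool)) {C D T : Finset V}
    (hCD : Disjoint C D) (hT : T ⊆ C ∪ D) :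
    ∑ τ ∈ A with I.vertex τ ∈ T, I.penalty τ.1 / 2 =
      ∑ τ ∈ A with I.vertex τ ∈ T ∩ C, I.penalty τ.1 / 2 +
      ∑ τ ∈ A with I.vertex τ ∈ T ∩ D, I.penalty τ.1 / 2 := by
  rw [Finset.sum_filter, Finset.sum_filter, Finset.sum_filter, ← Finset.sum_add_distrib]
  refine Finset.sum_congr rfl fun τ _ => ?_
  by_cases hτ : I.vertex τ ∈ T
  · have hdisj := Finset.disjoint_left.1 hCD
    rcases Finset.mem_union.1 (hT hτ) with h | h
    · simp [hτ, h, hdisj h]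
    · have : I.vertex τ ∉ C := fun h' => hdisj h' h
      simp [hτ, h, this]
  · simp [hτ]

variable [Fintype V]

theorem disjoint_component {F : Finset (Sym2 V)} {u v : V} (h : component F u ≠ component F v) :
    Disjoint (component F u) (component F v) := by
  rw [Finset.disjoint_left]
  intro w hu hv
  exact h ((component_eq_of_mem hu).symm.trans (component_eq_of_mem hv))

theorem not_component_union_subset {F : Finset (Sym2 V)} {u v : V}
    (h : component F u ≠ component F v) (w : V) :
    ¬ component F u ∪ component F v ⊆ component F w := by
  intro hs
  have h1 := component_eq_of_mem (hs (Finset.mem_union_left _ (self_mem_component F u)))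
  have h2 := component_eq_of_mem (hs (Finset.mem_union_right _ (self_mem_component F v)))
  exact h (h1.trans h2.symm)

variable [Fintype ι]

theorem Ledger.of_eq {I : PCSF V ι} {A : Finset (ι × Bool)} {st st' : PDState V ι}
    (h : Ledger I A st) (hf : st'.forest = st.forest) (hy : st'.y = st.y)
    (hp : st'.potential = st.potential) (hu : st'.uncharged = st.uncharged)
    (hc : st'.charge = st.charge) (hh : st'.history = st.history) : Ledger I A st' := by
  constructor <;> simp only [hf, hy, hp, hu, hc, hh]
  exacts [h.uncharged_nonneg, h.charge_nonneg, h.uncharged_supp, h.history_sorted,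
    h.mem_of_history, h.mem_history, h.charge_supp, h.balance, h.uncharged_sum_le,
    h.charge_sum_le, h.y_eq]

/-- A proper subset of a component contains no active component, so `uncharged_sum_le` changes only
when `T` is a whole component, where it says that the potential remains nonnegative. The hypothesis
`hhist` ensures that each newly uncharged set is in the histories of the unprocessed terminals
inside it. -/
theorem Ledger.grow {I : PCSF V ι} {A : Finset (ι × Bool)} {st : PDState V ι}
    (h : Ledger I A st) (hact : ∀ S ∈ st.active, S ∈ components st.forest)
    (hhist : ∀ τ ∈ A, component st.forest (I.vertex τ) ∈ st.history τ) {Δ : ℝ}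
    (hΔ : I.CanGrow st Δ) : Ledger I A (grow st Δ) := by
  have hcomp : ∀ S ∈ st.active, ∀ w ∈ S, S = component st.forest w := by
    intro S hS w hw
    obtain ⟨v, rfl⟩ := mem_components.1 (hact S hS)
    exact (component_eq_of_mem hw).symm
  have hne : ∀ S ∈ st.active, S.Nonempty := by
    intro S hS
    obtain ⟨v, rfl⟩ := mem_components.1 (hact S hS)
    exact ⟨v, self_mem_component _ v⟩
  have hpow : ∀ T : Finset V, ∑ S ∈ T.powerset, (PCSF.grow st Δ).uncharged S =
      ∑ S ∈ T.powerset, st.uncharged S + ∑ S ∈ T.powerset, if S ∈ st.active then Δ else 0 := by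
    intro T
    rw [← Finset.sum_add_distrib]
    refine Finset.sum_congr rfl fun S _ => ?_
    simp only [PCSF.grow]
    split_ifs <;> simp
  have hlt : ∀ v, ∀ T ⊆ component st.forest v, T ≠ component st.forest v →
      ∑ S ∈ T.powerset, (if S ∈ st.active then Δ else 0) = 0 := by
    intro v T hT hTv
    refine Finset.sum_eq_zero fun S hS => if_neg fun hSa => hTv ?_
    obtain ⟨w, hw⟩ := hne S hSa
    have hST := Finset.mem_powerset.1 hS
    have := hcomp S hSa w hw
    rw [component_eq_of_mem (hT (hST hw))] at this
    exact hT.antisymm (this ▸ hST)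
  have heq : ∀ v, ∑ S ∈ (component st.forest v).powerset, (if S ∈ st.active then Δ else 0) =
      if component st.forest v ∈ st.active then Δ else 0 := by
    intro v
    refine Finset.sum_eq_single_of_mem _ (Finset.mem_powerset.2 subset_rfl) fun S hS hSv => ?_
    refine if_neg fun hSa => hSv ?_
    obtain ⟨w, hw⟩ := hne S hSa
    rw [hcomp S hSa w hw, component_eq_of_mem (Finset.mem_powerset.1 hS hw)]
  have hbal : ∀ v, (PCSF.grow st Δ).potential (component st.forest v) +
      ∑ T ∈ (component st.forest v).powerset, (PCSF.grow st Δ).uncharged T =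
      ∑ τ ∈ A with I.vertex τ ∈ component st.forest v, I.penalty τ.1 / 2 := by
    intro v
    rw [hpow, heq, ← h.balance v]
    simp only [PCSF.grow]
    split_ifs <;> ring
  constructor
  · intro S
    simp only [PCSF.grow]
    split_ifs
    · exact add_nonneg (h.uncharged_nonneg S) hΔ.1
    · exact h.uncharged_nonneg S
  · exact h.charge_nonneg
  · intro S hS
    by_cases hSa : S ∈ st.active
    · obtain ⟨w, hw⟩ := hne S hSa
      exact ⟨w, hw, (hcomp S hSa w hw).subset⟩
    · exact h.uncharged_supp S (by simpa [PCSF.grow, hSa] using hS)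
  · exact h.history_sorted
  · exact h.mem_of_history
  · intro τ hτ S hτS hS
    by_cases hSa : S ∈ st.active
    · rw [hcomp S hSa _ hτS]
      exact hhist τ hτ
    · exact h.mem_history τ hτ S hτS (by simpa [PCSF.grow, hSa] using hS)
  · exact h.charge_supp
  · exact hbal
  · intro v T hT
    by_cases hTv : T = component st.forest v
    · subst hTv
      rw [← hbal v, le_add_iff_nonneg_left]
      simp only [PCSF.grow]
      split_ifs with hv
      · exact sub_nonneg.2 (hΔ.2.1 _ hv)
      · exact h.potential_nonneg v
    · rw [hpow, hlt v T hT hTv, add_zero]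
      exact h.uncharged_sum_le v T hT
  · exact h.charge_sum_le
  · intro S
    simp only [PCSF.grow]
    rw [h.y_eq S]
    split_ifs <;> ring

/-- The state right after two components have been joined, before the united pairs are treated. -/
def joinState (st : PDState V ι) (e : Sym2 V) (S₁ S₂ : Finset V) : PDState V ι :=
  { st with
    forest := insert e st.forest
    active := insert (S₁ ∪ S₂) (st.active \ {S₁, S₂})
    y := Function.update st.y (S₁ ∪ S₂) 0
    uncharged := Function.update st.uncharged (S₁ ∪ S₂) 0
    potential := Function.update st.potential (S₁ ∪ S₂) (st.potential S₁ + st.potential S₂) }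

/-- Only sets inside components carry growth, and the union fits inside no component. Hence, with
`Ledger.y_union`, the resets to `0` performed by a merge change nothing. -/
theorem Ledger.uncharged_union {I : PCSF V ι} {A : Finset (ι × Bool)} {st : PDState V ι}
    (h : Ledger I A st) {u v : V} (huv : component st.forest u ≠ component st.forest v) :
    st.uncharged (component st.forest u ∪ component st.forest v) = 0 := by
  by_contra hn
  obtain ⟨w, -, hw⟩ := h.uncharged_supp _ hn
  exact not_component_union_subset huv w hw

theorem Ledger.y_union {I : PCSF V ι} {A : Finset (ι × Bool)} {st : PDState V ι}
    (h : Ledger I A st) {u v : V} (huv : component st.forest u ≠ component st.forest v) :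
    st.y (component st.forest u ∪ component st.forest v) = 0 := by
  rw [h.y_eq, h.uncharged_union huv, zero_add]
  refine Finset.sum_eq_zero fun i _ => ?_
  by_contra hn
  obtain ⟨b, -, hb⟩ := h.charge_supp _ _ hn
  exact not_component_union_subset huv _ (h.mem_of_history _ _ _ hb).2.2

/-- A set with uncharged growth lies inside one of the two old components, so subsets of `T` meeting
both contribute nothing. -/
theorem Ledger.sum_powerset_union {I : PCSF V ι} {A : Finset (ι × Bool)} {st : PDState V ι}
    (h : Ledger I A st) {u v : V} (huv : component st.forest u ≠ component st.forest v)
    {T : Finset V} (hT : T ⊆ component st.forest u ∪ component st.forest v) :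
    ∑ S ∈ T.powerset, st.uncharged S =
      ∑ S ∈ (T ∩ component st.forest u).powerset, st.uncharged S +
      ∑ S ∈ (T ∩ component st.forest v).powerset, st.uncharged S := by
  have hdisj := Finset.disjoint_left.1 (disjoint_component huv)
  have hfil : ∀ C : Finset V, (T ∩ C).powerset = T.powerset.filter (· ⊆ C) := by
    intro C
    ext S
    simp only [Finset.mem_powerset, Finset.mem_filter, Finset.subset_inter_iff]
  rw [hfil, hfil, Finset.sum_filter, Finset.sum_filter, ← Finset.sum_add_distrib]
  refine Finset.sum_congr rfl fun S hS => ?_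
  by_cases hS0 : st.uncharged S = 0
  · simp [hS0]
  · obtain ⟨w, hw, hSw⟩ := h.uncharged_supp S hS0
    rcases Finset.mem_union.1 (hT (Finset.mem_powerset.1 hS hw)) with hwu | hwv
    · rw [component_eq_of_mem hwu] at hSw
      rw [if_pos hSw, if_neg fun h' => hdisj hwu (h' hw), add_zero]
    · rw [component_eq_of_mem hwv] at hSw
      rw [if_pos hSw, if_neg fun h' => hdisj (h' hw) hwv, zero_add]

theorem Ledger.join {I : PCSF V ι} {A : Finset (ι × Bool)} {st : PDState V ι}
    (h : Ledger I A st) {u v : V} (huv : component st.forest u ≠ component st.forest v) :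
    Ledger I A (joinState st s(u, v) (component st.forest u) (component st.forest v)) := by
  have hu : Function.update st.uncharged (component st.forest u ∪ component st.forest v) 0 =
      st.uncharged := by rw [Function.update_eq_self_iff, h.uncharged_union huv]
  have hy : Function.update st.y (component st.forest u ∪ component st.forest v) 0 =
      st.y := by rw [Function.update_eq_self_iff, h.y_union huv]
  have hsub : st.forest ⊆ insert s(u, v) st.forest := Finset.subset_insert _ _
  have hdisj := disjoint_component huv
  have e1 : ∀ {C D : Finset V}, (C ∪ D) ∩ C = C := fun {C D} =>
    Finset.inter_eq_right.2 Finset.subset_union_left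
  have e2 : ∀ {C D : Finset V}, (C ∪ D) ∩ D = D := fun {C D} =>
    Finset.inter_eq_right.2 Finset.subset_union_right
  unfold joinState
  constructor <;> simp only [hu, hy]
  · exact h.uncharged_nonneg
  · exact h.charge_nonneg
  · intro S hS
    obtain ⟨w, hw, hSw⟩ := h.uncharged_supp S hS
    exact ⟨w, hw, hSw.trans (component_mono hsub w)⟩
  · exact h.history_sorted
  · intro i b S hS
    obtain ⟨h1, h2, h3⟩ := h.mem_of_history i b S hS
    exact ⟨h1, h2, h3.trans (component_mono hsub _)⟩
  · exact h.mem_history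
  · exact h.charge_supp
  · intro w
    by_cases hw : w ∈ component st.forest u ∪ component st.forest v
    · rw [component_insert_of_mem hw, Function.update_self, h.sum_powerset_union huv subset_rfl,
        sum_filter_vertex_union I A hdisj subset_rfl, e1, e2, ← h.balance u, ← h.balance v]
      ring
    · rw [component_insert_of_notMem hw, Function.update_of_ne]
      · exact h.balance w
      · exact fun h' => not_component_union_subset huv w h'.ge
  · intro w T hT
    by_cases hw : w ∈ component st.forest u ∪ component st.forest v
    · rw [component_insert_of_mem hw] at hT
      rw [h.sum_powerset_union huv hT, sum_filter_vertex_union I A hdisj hT]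
      exact add_le_add (h.uncharged_sum_le u _ Finset.inter_subset_right)
        (h.uncharged_sum_le v _ Finset.inter_subset_right)
    · rw [component_insert_of_notMem hw] at hT
      exact h.uncharged_sum_le w T hT
  · exact h.charge_sum_le
  · exact h.y_eq

theorem Ledger.settle {I : PCSF V ι} {A : Finset (ι × Bool)} {st : PDState V ι}
    (h : Ledger I A st) {S : Finset V} {τ : ι × Bool}
    (hS : S = component st.forest (I.vertex τ)) (hA : τ ∈ A ↔ st.label τ = .alive) :
    Ledger I (A.erase τ) (I.settle S st τ) := by
  unfold PCSF.settle
  split_ifs with hal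
  · exact (h.process (hA.2 hal) hS).of_eq rfl rfl rfl rfl rfl rfl
  · rwa [Finset.erase_eq_of_notMem fun h' => hal (hA.1 h')]

theorem Ledger.charge_le_settle {I : PCSF V ι} {A : Finset (ι × Bool)} {st : PDState V ι}
    (h : Ledger I A st) (S : Finset V) {τ : ι × Bool} (hA : τ ∈ A ↔ st.label τ = .alive)
    (j : ι) (T : Finset V) : st.charge j T ≤ (I.settle S st τ).charge j T := by
  unfold PCSF.settle
  split_ifs with hal
  · exact (h.loopSpec (hA.2 hal)).charge_le j T
  · exact le_rfl

end PCSF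

namespace PCSF

variable {V ι : Type*}

/-! ### The invariant of the algorithm -/

/-- The terminals that are alive. -/
def aliveSet [Fintype ι] (st : PDState V ι) : Finset (ι × Bool) := {τ | st.label τ = .alive}

theorem mem_aliveSet [Fintype ι] {st : PDState V ι} {τ : ι × Bool} :
    τ ∈ aliveSet st ↔ st.label τ = .alive := by
  simp [aliveSet]

theorem load_grow [Fintype V] (st : PDState V ι) (Δ : ℝ) (e : Sym2 V) :
    load (grow st Δ) e = load st e + (st.active.filter (Crosses e ·)).card * Δ := by
  have h1 : ∀ S, (grow st Δ).y S = st.y S + if S ∈ st.active then Δ else 0 := by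
    intro S
    simp only [grow]
    split_ifs <;> simp
  simp only [load, h1]
  rw [Finset.sum_add_distrib, ← Finset.sum_filter, Finset.sum_const, nsmul_eq_mul]
  have h2 : (Finset.univ.filter (Crosses e ·)).filter (· ∈ st.active) =
      st.active.filter (Crosses e ·) := by
    ext S
    simp [and_comm]
  rw [h2]

theorem unites_of_not_separated_insert [Fintype V] {I : PCSF V ι} {F : Finset (Sym2 V)} {u v : V} {i : ι}
    (h : I.Separated F i) (h' : ¬ I.Separated (insert s(u, v) F) i) :
    I.Unites (component F u) (component F v) i := by
  rcases joined_insert.1 (not_not.1 h') with hj | hj | hj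
  · exact absurd hj h
  · exact .inl ⟨mem_component.2 hj.1.symm, mem_component.2 hj.2⟩
  · exact .inr ⟨mem_component.2 hj.1.symm, mem_component.2 hj.2⟩

theorem separated_of_unites [Fintype V] {I : PCSF V ι} {F : Finset (Sym2 V)} {u v : V} {i : ι}
    (huv : component F u ≠ component F v)
    (h : I.Unites (component F u) (component F v) i) : I.Separated F i := by
  intro hj
  have hst := component_eq_iff.2 hj
  rcases h with ⟨h1, h2⟩ | ⟨h1, h2⟩
  · exact huv (by rw [← component_eq_of_mem h1, hst, component_eq_of_mem h2])
  · exact huv (by rw [← component_eq_of_mem h2, ← hst, component_eq_of_mem h1])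

theorem vertex_mem_of_unites {I : PCSF V ι} {C D : Finset V} {i : ι} (h : I.Unites C D i)
    (b : Bool) : I.vertex (i, b) ∈ C ∪ D := by
  rcases h with ⟨h1, h2⟩ | ⟨h1, h2⟩ <;> cases b <;> simp [vertex, h1, h2]

variable [Fintype V] [Fintype ι]

/-- The invariant of the algorithm, in the middle of an iteration: the histories of the terminals
in `S` are not yet extended, the pairs in `l` have been united but not yet treated, and the
terminals in `k` lie in a component that has just become inactive. -/
structure PartialInv (I : PCSF V ι) (S : Finset V) (l : List ι) (k : List (ι × Bool))
    (st : PDState V ι) : Prop where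
  forest_sub : (st.forest : Set (Sym2 V)) ⊆ I.graph.edgeSet
  acyclic : (SimpleGraph.fromEdgeSet (st.forest : Set (Sym2 V))).IsAcyclic
  active_sub : ∀ T ∈ st.active, T ∈ components st.forest
  ledger : Ledger I (aliveSet st) st
  mem_history : ∀ τ, st.label τ = .alive → I.vertex τ ∉ S →
    component st.forest (I.vertex τ) ∈ st.history τ
  mem_active : ∀ τ, st.label τ = .alive → τ ∉ k → component st.forest (I.vertex τ) ∈ st.active
  separated : ∀ i b, st.label (i, b) = .alive → i ∉ l → I.Separated st.forest i
  satisfied : ∀ i b, st.label (i, b) = .satisfied →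
    st.label (i, !b) = .satisfied ∧ ¬ I.Separated st.forest i
  not_satisfied : ∀ i ∈ l, ∀ b, st.label (i, b) ≠ .satisfied
  dead : ∀ i b, st.label (i, b) = .dead → I.penalty i / 2 ≤ ∑ T, st.charge i T
  load_le : ∀ e ∈ I.graph.edgeSet, load st e ≤ I.cost e
  load_eq : ∀ e ∈ st.forest, load st e = I.cost e

/-- The invariant of the algorithm between two iterations. -/
abbrev Inv (I : PCSF V ι) (st : PDState V ι) : Prop := PartialInv I ∅ [] [] st

theorem ledger_initState (I : PCSF V ι) : Ledger I (aliveSet I.initState) I.initState := by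
  constructor
  · intro S; exact le_rfl
  · intro i S; exact le_rfl
  · intro S hS; exact absurd rfl hS
  · intro τ; exact List.pairwise_singleton _ _
  · intro i b S hS
    obtain rfl : S = {I.vertex (i, b)} := by simpa [initState] using hS
    refine ⟨Finset.mem_singleton_self _, ?_, Finset.singleton_subset_iff.2 (self_mem_component _ _)⟩
    have := I.s_ne_t i
    cases b <;> simp [vertex, this, this.symm]
  · intro τ _ S _ hS; exact absurd rfl hS
  · intro i S hS; exact absurd rfl hS
  · intro v
    have h0 : I.initState.forest = ∅ := rfl
    rw [h0, component_empty]
    simp only [initState, Finset.sum_const_zero, add_zero, Finset.singleton_inj,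
      Finset.mem_singleton]
    refine Finset.sum_congr ?_ fun _ _ => rfl
    ext τ
    simp [aliveSet, eq_comm]
  · intro v T _
    simp only [initState, Finset.sum_const_zero]
    exact Finset.sum_nonneg fun τ _ => div_nonneg (I.penalty_nonneg _) zero_le_two
  · intro i
    simp only [initState, Finset.sum_const_zero]
    exact Finset.sum_nonneg fun τ _ => div_nonneg (I.penalty_nonneg _) zero_le_two
  · intro S; simp [initState]

theorem inv_initState (I : PCSF V ι) : Inv I I.initState := by
  have h0 : I.initState.forest = ∅ := rfl
  have hload : ∀ e, load I.initState e = 0 := fun e => Finset.sum_eq_zero fun _ _ => rfl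
  constructor
  · simp [h0]
  · simp [h0]
  · intro T hT
    obtain ⟨τ, -, rfl⟩ := Finset.mem_image.1 hT
    exact mem_components.2 ⟨I.vertex τ, by rw [h0, component_empty]⟩
  · exact ledger_initState I
  · intro τ _ _
    rw [h0, component_empty]
    exact List.mem_singleton_self _
  · intro τ _ _
    rw [h0, component_empty]
    exact Finset.mem_image_of_mem _ (Finset.mem_univ τ)
  · intro i b _ _ h
    have := component_eq_iff.2 h
    rw [h0, component_empty, component_empty, Finset.singleton_inj] at this
    exact I.s_ne_t i this
  · intro i b h; exact absurd h (by simp [initState])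
  · simp
  · intro i b h; exact absurd h (by simp [initState])
  · intro e he
    rw [hload]
    exact I.cost_nonneg e he
  · simp [h0]

theorem Inv.not_crosses {I : PCSF V ι} {st : PDState V ι} (h : Inv I st) {e : Sym2 V}
    (he : e ∈ st.forest) : st.active.filter (Crosses e ·) = ∅ := by
  rw [Finset.filter_eq_empty_iff]
  intro S hS
  obtain ⟨v, rfl⟩ := mem_components.1 (h.active_sub S hS)
  exact not_crosses_component he v

theorem Inv.grow {I : PCSF V ι} {st : PDState V ι} (h : Inv I st) {Δ : ℝ}
    (hΔ : I.CanGrow st Δ) : Inv I (grow st Δ) where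
  forest_sub := h.forest_sub
  acyclic := h.acyclic
  active_sub := h.active_sub
  ledger := h.ledger.grow h.active_sub
    (fun τ hτ => h.mem_history τ (mem_aliveSet.1 hτ) (Finset.notMem_empty _)) hΔ
  mem_history := h.mem_history
  mem_active := h.mem_active
  separated := h.separated
  satisfied := h.satisfied
  not_satisfied := h.not_satisfied
  dead := h.dead
  load_le := hΔ.2.2
  load_eq e he := by
    rw [load_grow, h.not_crosses he, Finset.card_empty, Nat.cast_zero, zero_mul, add_zero]
    exact h.load_eq e he

/-- The ledger passes through two applications of `Ledger.settle`; settling the first terminal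
leaves the label of the second unchanged. If the pair becomes dead, the required charge is that of a
terminal that was dead before, as charges never decrease. -/
theorem PartialInv.unite {I : PCSF V ι} {S : Finset V} {i : ι} {l : List ι} {st : PDState V ι}
    (h : PartialInv I S (i :: l) [] st) (hi : i ∉ l)
    (hS : ∀ b, component st.forest (I.vertex (i, b)) = S) :
    PartialInv I S l [] (I.unite S st i) := by
  set A := aliveSet st with hA
  have hne : ((i, false) : ι × Bool) ≠ (i, true) := by simp
  have hA2 : (i, false) ∈ A.erase (i, true) ↔
      (I.settle S st (i, true)).label (i, false) = .alive := by
    rw [Finset.mem_erase, settle_label, and_iff_right hne, hA, mem_aliveSet]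
  have L1 := h.ledger.settle (hS true).symm mem_aliveSet
  have L2 := L1.settle (S := S) (τ := (i, false)) (by rw [settle_forest, hS false]) hA2
  have hal : aliveSet (I.unite S st i) = (A.erase (i, true)).erase (i, false) := by
    ext ⟨j, b⟩
    rw [mem_aliveSet]
    by_cases hj : j = i
    · subst hj
      rw [unite_label_self]
      cases b <;> simp <;> split_ifs <;> simp
    · rw [unite_label_of_ne _ _ _ hj]
      simp [hj, hA, mem_aliveSet]
  have hch : ∀ j T, st.charge j T ≤ (I.unite S st i).charge j T := fun j T =>
    (h.ledger.charge_le_settle S mem_aliveSet j T).trans (L1.charge_le_settle S hA2 j T)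
  have halive : ∀ τ, (I.unite S st i).label τ = .alive → τ.1 ≠ i ∧ st.label τ = .alive := by
    rintro ⟨j, b⟩ hτ
    by_cases hj : j = i
    · subst hj
      rw [unite_label_self] at hτ
      split_ifs at hτ
    · exact ⟨hj, by rwa [unite_label_of_ne _ _ _ hj] at hτ⟩
  have hload : ∀ e, load (I.unite S st i) e = load st e := fun e => by
    simp only [load, unite_y]
  constructor
  · rw [unite_forest]; exact h.forest_sub
  · rw [unite_forest]; exact h.acyclic
  · rw [unite_forest, unite_active]; exact h.active_sub
  · rw [hal]
    exact L2.of_eq rfl rfl rfl rfl rfl rfl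
  · intro τ hτ hτS
    rw [unite_forest, unite_history]
    exact h.mem_history τ (halive τ hτ).2 hτS
  · intro τ hτ hk
    rw [unite_forest, unite_active]
    exact h.mem_active τ (halive τ hτ).2 hk
  · intro j b hj hjl
    rw [unite_forest]
    exact h.separated j b (halive _ hj).2 (by simp [(halive _ hj).1, hjl])
  · intro j b hj
    rw [unite_forest]
    by_cases hji : j = i
    · subst hji
      rw [unite_label_self] at hj ⊢
      refine ⟨hj, not_not.2 (component_eq_iff.1 ((hS true).trans (hS false).symm))⟩
    · rw [unite_label_of_ne _ _ _ hji] at hj ⊢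
      exact h.satisfied j b hj
  · intro j hj b
    rw [unite_label_of_ne _ _ _ fun hji : j = i => hi (hji ▸ hj)]
    exact h.not_satisfied j (List.mem_cons_of_mem _ hj) b
  · intro j b hj
    have hle : ∑ T, st.charge j T ≤ ∑ T, (I.unite S st i).charge j T :=
      Finset.sum_le_sum fun T _ => hch j T
    refine le_trans ?_ hle
    by_cases hji : j = i
    · subst hji
      have hns := h.not_satisfied j List.mem_cons_self
      rw [unite_label_self] at hj
      -- Not both terminals were alive, and `not_satisfied` rules out `satisfied`, so one of them
      -- was already dead.
      obtain ⟨b', hb'⟩ : ∃ b', st.label (j, b') ≠ .alive := by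
        by_contra! hall
        rw [if_pos ⟨hall true, hall false⟩] at hj
        exact absurd hj (by simp)
      refine h.dead j b' ?_
      have := hns b'
      cases hlab : st.label (j, b') <;> simp_all
    · rw [unite_label_of_ne _ _ _ hji] at hj
      exact h.dead j b hj
  · intro e he
    rw [hload]; exact h.load_le e he
  · intro e he
    rw [unite_forest] at he
    rw [hload]; exact h.load_eq e he

theorem PartialInv.foldl_unite {I : PCSF V ι} {S : Finset V} {l : List ι} {st : PDState V ι}
    (h : PartialInv I S l [] st) (hl : l.Nodup)
    (hS : ∀ i ∈ l, ∀ b, component st.forest (I.vertex (i, b)) = S) :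
    PartialInv I S [] [] (l.foldl (I.unite S) st) := by
  induction l generalizing st with
  | nil => exact h
  | cons i l ih =>
    rw [List.nodup_cons] at hl
    refine ih (h.unite hl.1 (hS i List.mem_cons_self)) hl.2 fun j hj b => ?_
    rw [unite_forest]
    exact hS j (List.mem_cons_of_mem _ hj) b

theorem Inv.join {I : PCSF V ι} {st : PDState V ι} (h : Inv I st) {u v : V}
    (hadj : I.graph.Adj u v) (huv : component st.forest u ≠ component st.forest v)
    (htight : load st s(u, v) = I.cost s(u, v)) {l : List ι}
    (hl : ∀ i, i ∈ l ↔ I.Unites (component st.forest u) (component st.forest v) i) :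
    PartialInv I (component st.forest u ∪ component st.forest v) l []
      (joinState st s(u, v) (component st.forest u) (component st.forest v)) := by
  have hload : ∀ e, load (joinState st s(u, v) (component st.forest u) (component st.forest v)) e =
      load st e := fun e => by
    have hy : Function.update st.y (component st.forest u ∪ component st.forest v) 0 = st.y := by
      rw [Function.update_eq_self_iff, h.ledger.y_union huv]
    simp only [load, joinState, hy]
  constructor
  · simp only [joinState, Finset.coe_insert]
    exact Set.insert_subset ((SimpleGraph.mem_edgeSet _).2 hadj) h.forest_sub
  · simp only [joinState]
    rw [fromEdgeSet_insert]
    exact h.acyclic.sup_edge_of_not_reachable fun hj => huv (component_eq_iff.2 hj)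
  · intro T hT
    simp only [joinState] at hT ⊢
    rw [components_insert]
    refine Finset.insert_subset_insert _ (Finset.sdiff_subset_sdiff ?_ subset_rfl) hT
    exact fun T hT => h.active_sub T hT
  · exact h.ledger.join huv
  · intro τ hτ hτS
    simp only [joinState]
    rw [component_insert_of_notMem hτS]
    exact h.mem_history τ hτ (Finset.notMem_empty _)
  · intro τ hτ hk
    simp only [joinState]
    by_cases hτS : I.vertex τ ∈ component st.forest u ∪ component st.forest v
    · rw [component_insert_of_mem hτS]
      exact Finset.mem_insert_self _ _
    · rw [component_insert_of_notMem hτS]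
      refine Finset.mem_insert_of_mem (Finset.mem_sdiff.2 ⟨h.mem_active τ hτ hk, ?_⟩)
      rw [Finset.mem_insert, Finset.mem_singleton]
      rw [Finset.mem_union, not_or] at hτS
      rintro (h' | h')
      · exact hτS.1 (h' ▸ self_mem_component _ _)
      · exact hτS.2 (h' ▸ self_mem_component _ _)
  · intro i b hi hil
    by_contra hn
    exact hil ((hl i).2 (unites_of_not_separated_insert
      (h.separated i b hi List.not_mem_nil) hn))
  · intro i b hi
    refine ⟨(h.satisfied i b hi).1, not_not.2 ?_⟩
    exact Joined.mono (Finset.subset_insert _ _) (not_not.1 (h.satisfied i b hi).2)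
  · intro i hi b hb
    exact (h.satisfied i b hb).2 (separated_of_unites huv ((hl i).1 hi))
  · exact h.dead
  · intro e he
    rw [hload]
    exact h.load_le e he
  · intro e he
    rw [hload]
    rcases Finset.mem_insert.1 he with rfl | he
    · exact htight
    · exact h.load_eq e he

theorem Inv.merge {I : PCSF V ι} {st : PDState V ι} (h : Inv I st) {u v : V}
    (hadj : I.graph.Adj u v) (huv : component st.forest u ≠ component st.forest v)
    (htight : load st s(u, v) = I.cost s(u, v)) {l : List ι}
    (hl : Enumerates l (I.Unites (component st.forest u) (component st.forest v))) :
    Inv I (I.merge st s(u, v) (component st.forest u) (component st.forest v) l) := by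
  set S := component st.forest u ∪ component st.forest v with hS
  set st₁ := joinState st s(u, v) (component st.forest u) (component st.forest v) with hst₁
  set st₂ := l.foldl (I.unite S) st₁ with hst₂
  have hf : st₂.forest = insert s(u, v) st.forest := by
    rw [hst₂, foldl_unite_forest]; rfl
  have ha : st₂.active = insert S (st.active \ {component st.forest u, component st.forest v}) := by
    rw [hst₂, foldl_unite_active]; rfl
  have hh : st₂.history = st.history := by
    rw [hst₂, foldl_unite_history]; rfl
  have hcS : ∀ w ∈ S, component st₂.forest w = S := fun w hw => by
    rw [hf]; exact component_insert_of_mem hw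
  have P : PartialInv I S [] [] st₂ := by
    refine (h.join hadj huv htight hl.2).foldl_unite hl.1 fun i hi b => ?_
    exact component_insert_of_mem (vertex_mem_of_unites ((hl.2 i).1 hi) b)
  have hmerge : I.merge st s(u, v) (component st.forest u) (component st.forest v) l =
      { st₂ with history := fun τ => if I.vertex τ ∈ S ∧ st₂.label τ = .alive
          then st₂.history τ ++ [S] else st₂.history τ } := rfl
  rw [hmerge]
  have hmono : ∀ τ, ∀ T ∈ st₂.history τ, T ∈ (if I.vertex τ ∈ S ∧ st₂.label τ = .alive
      then st₂.history τ ++ [S] else st₂.history τ) := by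
    intro τ T hT
    split_ifs
    · exact List.mem_append_left _ hT
    · exact hT
  -- Treating the united pairs does not alter histories, so their sets still lie inside components
  -- of the old forest, and `S` does not.
  have hlt : ∀ τ, I.vertex τ ∈ S → ∀ T ∈ st₂.history τ, T ⊂ S := by
    intro τ hτ T hT
    have h1 := (P.ledger.mem_of_history τ.1 τ.2 T hT).2.2
    rw [Prod.mk.eta, hcS _ hτ] at h1
    refine h1.ssubset_of_ne fun hTS => ?_
    rw [hh] at hT
    exact not_component_union_subset huv _
      (hS ▸ hTS ▸ (h.ledger.mem_of_history τ.1 τ.2 T hT).2.2)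
  refine ⟨P.forest_sub, P.acyclic, P.active_sub, ⟨P.ledger.uncharged_nonneg,
    P.ledger.charge_nonneg, P.ledger.uncharged_supp, ?_, ?_, ?_, ?_, P.ledger.balance,
    P.ledger.uncharged_sum_le, P.ledger.charge_sum_le, P.ledger.y_eq⟩, ?_, P.mem_active,
    P.separated, P.satisfied, P.not_satisfied, P.dead, P.load_le, P.load_eq⟩
  · intro τ
    simp only
    split_ifs with hτ
    · rw [List.pairwise_append]
      refine ⟨P.ledger.history_sorted τ, List.pairwise_singleton _ _, fun T hT R hR => ?_⟩
      obtain rfl := List.mem_singleton.1 hR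
      exact hlt τ hτ.1 T hT
    · exact P.ledger.history_sorted τ
  · intro i b T hT
    simp only at hT
    split_ifs at hT with hτ
    · rcases List.mem_append.1 hT with hT | hT
      · exact P.ledger.mem_of_history i b T hT
      · obtain rfl := List.mem_singleton.1 hT
        -- A pair with an alive terminal is separated by the new forest, so the partner cannot lie
        -- in the component `S`.
        refine ⟨hτ.1, fun hb => P.separated i b hτ.2 List.not_mem_nil ?_, (hcS _ hτ.1).ge⟩
        refine component_eq_iff.1 ?_
        have h1 := (hcS _ hτ.1).trans (hcS _ hb).symm
        cases b
        · exact h1.symm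
        · exact h1
    · exact P.ledger.mem_of_history i b T hT
  · exact fun τ hτ T hτT hT => hmono τ T (P.ledger.mem_history τ hτ T hτT hT)
  · intro i T hT
    obtain ⟨b, hb, hbT⟩ := P.ledger.charge_supp i T hT
    exact ⟨b, hb, hmono _ T hbT⟩
  · intro τ hτ _
    simp only
    by_cases hτS : I.vertex τ ∈ S
    · rw [hcS _ hτS, if_pos ⟨hτS, hτ⟩]
      exact List.mem_append_right _ (List.mem_singleton_self _)
    · exact hmono τ _ (P.mem_history τ hτ hτS)

/-- Lowering the potential by the returned number would keep the ledger and hence a nonnegative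
potential. As the potential is already `0`, the returned number is `0`: not lowering it makes no
difference, and `τ` pays its full half penalty, as `dead` demands. -/
theorem PartialInv.kill {I : PCSF V ι} {τ : ι × Bool} {k : List (ι × Bool)} {st : PDState V ι}
    (h : PartialInv I ∅ [] (τ :: k) st) (hτ : st.label τ = .alive)
    (hpot : st.potential (component st.forest (I.vertex τ)) = 0) :
    PartialInv I ∅ [] k (I.kill st τ) := by
  have hA := mem_aliveSet.2 hτ
  have sp := h.ledger.loopSpec hA
  have L := h.ledger.process hA rfl
  have hr := L.potential_nonneg (I.vertex τ)
  have hr0 : (I.processHistory st τ).1 = 0 := by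
    have h1 : 0 ≤ (I.processHistory st τ).1 := sp.fst_nonneg
    have h2 : (Function.update st.potential (component st.forest (I.vertex τ))
      (st.potential (component st.forest (I.vertex τ)) - (I.processHistory st τ).1))
        (component st.forest (I.vertex τ)) = - (I.processHistory st τ).1 := by
      rw [Function.update_self, hpot, zero_sub]
    have h3 := hr.trans_eq h2
    linarith
  have hal : aliveSet (I.kill st τ) = (aliveSet st).erase τ := by
    ext σ
    rw [mem_aliveSet, kill_label, Finset.mem_erase, mem_aliveSet]
    by_cases hσ : σ = τ
    · subst hσ; simp
    · simp [hσ]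
  have hsum : ∑ T, (I.kill st τ).charge τ.1 T = ∑ T, st.charge τ.1 T +
      (I.penalty τ.1 / 2 - (I.processHistory st τ).1) := sp.sum_charge
  rw [hr0, sub_zero] at hsum
  have hlab : ∀ σ x, x ≠ TerminalLabel.dead → (I.kill st τ).label σ = x →
      σ ≠ τ ∧ st.label σ = x := by
    intro σ x hx hσx
    rw [kill_label] at hσx
    by_cases hσ : σ = τ
    · subst hσ
      rw [Function.update_self] at hσx
      exact absurd hσx.symm hx
    · rw [Function.update_of_ne hσ] at hσx
      exact ⟨hσ, hσx⟩
  refine ⟨h.forest_sub, h.acyclic, h.active_sub, ?_, ?_, ?_, ?_, ?_, ?_, ?_, h.load_le, h.load_eq⟩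
  · rw [hal]
    refine L.of_eq rfl rfl ?_ rfl rfl rfl
    simp only [hr0, sub_zero, Function.update_eq_self]
    rfl
  · exact fun σ hσ hσS => h.mem_history σ (hlab σ _ (by simp) hσ).2 hσS
  · intro σ hσ hk
    obtain ⟨h1, h2⟩ := hlab σ _ (by simp) hσ
    exact h.mem_active σ h2 (by simp [h1, hk])
  · exact fun i b hi hil => h.separated i b (hlab _ _ (by simp) hi).2 hil
  · intro i b hi
    obtain ⟨h1, h2⟩ := h.satisfied i b (hlab _ _ (by simp) hi).2
    refine ⟨?_, h2⟩
    rw [kill_label, Function.update_of_ne, h1]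
    rintro rfl
    rw [h1] at hτ
    exact absurd hτ (by simp)
  · simp
  · intro i b hi
    by_cases hiτ : (i, b) = τ
    · subst hiτ
      rw [hsum]
      exact le_add_of_nonneg_left (Finset.sum_nonneg fun T _ => h.ledger.charge_nonneg i T)
    · rw [kill_label, Function.update_of_ne hiτ] at hi
      exact (h.dead i b hi).trans (Finset.sum_le_sum fun T _ => sp.charge_le i T)

theorem PartialInv.foldl_kill {I : PCSF V ι} {k : List (ι × Bool)} {st : PDState V ι}
    (h : PartialInv I ∅ [] k st) (hk : k.Nodup)
    (hal : ∀ τ ∈ k, st.label τ = .alive ∧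
      st.potential (component st.forest (I.vertex τ)) = 0) :
    Inv I (k.foldl I.kill st) := by
  induction k generalizing st with
  | nil => exact h
  | cons τ k ih =>
    rw [List.nodup_cons] at hk
    have hτ := hal τ List.mem_cons_self
    refine ih (h.kill hτ.1 hτ.2) hk.2 fun σ hσ => ?_
    have hσ' := hal σ (List.mem_cons_of_mem _ hσ)
    refine ⟨?_, hσ'.2⟩
    rw [kill_label, Function.update_of_ne fun hστ : σ = τ => hk.1 (hστ ▸ hσ), hσ'.1]

theorem Inv.deactivate {I : PCSF V ι} {st : PDState V ι} (h : Inv I st) {S : Finset V}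
    (hS : S ∈ st.active) (hpot : st.potential S = 0) {k : List (ι × Bool)}
    (hk : Enumerates k (fun τ => I.vertex τ ∈ S ∧ st.label τ = .alive)) :
    Inv I (I.deactivate st S k) := by
  obtain ⟨v, rfl⟩ := mem_components.1 (h.active_sub S hS)
  have P : PartialInv I ∅ [] k
      { st with active := st.active.erase (component st.forest v) } := by
    refine ⟨h.forest_sub, h.acyclic, fun T hT => h.active_sub T (Finset.mem_of_mem_erase hT),
      h.ledger.of_eq rfl rfl rfl rfl rfl rfl, h.mem_history, ?_, h.separated, h.satisfied,
      h.not_satisfied, h.dead, h.load_le, h.load_eq⟩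
    intro τ hτ hτk
    refine Finset.mem_erase.2 ⟨fun h' => hτk ((hk.2 τ).2 ⟨?_, hτ⟩),
      h.mem_active τ hτ List.not_mem_nil⟩
    exact h' ▸ self_mem_component _ _
  refine P.foldl_kill hk.1 fun τ hτ => ?_
  have hτ' := (hk.2 τ).1 hτ
  refine ⟨hτ'.2, ?_⟩
  simp only
  rw [component_eq_of_mem hτ'.1, hpot]

theorem Inv.step {I : PCSF V ι} {st st' : PDState V ι} (h : Inv I st) (hs : I.Step st st') :
    Inv I st' := by
  cases hs with
  | addEdge Δ hΔ u v huv hne hact htight l hl =>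
    exact (h.grow hΔ).merge huv hne htight hl
  | exhaust Δ hΔ S hS hpot l hl =>
    exact (h.grow hΔ).deactivate hS hpot hl

theorem inv_of_reachable {I : PCSF V ι} {st : PDState V ι}
    (h : Relation.ReflTransGen I.Step I.initState st) : Inv I st := by
  induction h with
  | refl => exact inv_initState I
  | tail _ hs ih => exact ih.step hs

end PCSF

namespace PCSF

variable {V ι : Type*}

/-! ### The deletion phase -/

theorem Separated.anti {I : PCSF V ι} {F F' : Finset (Sym2 V)} (h : F ⊆ F') {i : ι}
    (hi : I.Separated F' i) : I.Separated F i := fun h' => hi (Joined.mono h h')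

/-- `F` connects all satisfied pairs. -/
def ConnectsSatisfied (I : PCSF V ι) (st : PDState V ι) (F : Finset (Sym2 V)) : Prop :=
  ∀ i, st.label (i, true) = .satisfied → st.label (i, false) = .satisfied → ¬ I.Separated F i

/-- Every edge of `F` is needed to connect a satisfied pair. -/
def EdgesNeeded (I : PCSF V ι) (st : PDState V ι) (F : Finset (Sym2 V)) : Prop :=
  ∀ e ∈ F, ∃ i, st.label (i, true) = .satisfied ∧ st.label (i, false) = .satisfied ∧
    I.Separated (F.erase e) i

theorem deleteEdge_subset (I : PCSF V ι) (st : PDState V ι) (F : Finset (Sym2 V)) (e : Sym2 V) :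
    I.deleteEdge st F e ⊆ F := by
  unfold deleteEdge
  split_ifs
  · rfl
  · exact Finset.erase_subset _ _

theorem foldl_deleteEdge_subset (I : PCSF V ι) (st : PDState V ι) (l : List (Sym2 V))
    (F : Finset (Sym2 V)) : l.foldl (I.deleteEdge st) F ⊆ F := by
  induction l generalizing F with
  | nil => rfl
  | cons e l ih => exact (ih _).trans (deleteEdge_subset I st F e)

theorem ConnectsSatisfied.foldl_deleteEdge {I : PCSF V ι} {st : PDState V ι}
    {F : Finset (Sym2 V)} (h : ConnectsSatisfied I st F) (l : List (Sym2 V)) :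
    ConnectsSatisfied I st (l.foldl (I.deleteEdge st) F) := by
  induction l generalizing F with
  | nil => exact h
  | cons e l ih =>
    refine ih fun i h1 h2 => ?_
    unfold deleteEdge
    split_ifs with hif
    · exact h i h1 h2
    · exact fun h3 => hif ⟨i, h1, h2, h3⟩

/-- An edge is kept because its removal would separate a satisfied pair at that moment. Later
deletions only shrink the forest, so the edge stays needed. -/
theorem needed_of_mem_foldl_deleteEdge {I : PCSF V ι} {st : PDState V ι} (l : List (Sym2 V))
    (F : Finset (Sym2 V)) (e : Sym2 V) (he : e ∈ l) (heF : e ∈ l.foldl (I.deleteEdge st) F) :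
    ∃ i, st.label (i, true) = .satisfied ∧ st.label (i, false) = .satisfied ∧
      I.Separated ((l.foldl (I.deleteEdge st) F).erase e) i := by
  induction l generalizing F with
  | nil => exact absurd he List.not_mem_nil
  | cons e' l ih =>
    rcases List.mem_cons.1 he with rfl | he
    · have hsub := foldl_deleteEdge_subset I st l (I.deleteEdge st F e)
      have hmem := hsub heF
      by_cases hif : ∃ i, st.label (i, true) = .satisfied ∧ st.label (i, false) = .satisfied ∧
          I.Separated (F.erase e) i
      · obtain ⟨i, h1, h2, h3⟩ := hif
        refine ⟨i, h1, h2, h3.anti (Finset.erase_subset_erase _ ?_)⟩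
        exact hsub.trans (deleteEdge_subset I st F e)
      · rw [deleteEdge, if_neg hif] at hmem
        exact absurd hmem (Finset.notMem_erase _ _)
    · exact ih _ he heF

/-! ### Monotonicity along a run -/

theorem foldl_unite_dead (I : PCSF V ι) (S : Finset V) (l : List ι) (st : PDState V ι)
    {τ : ι × Bool} (h : st.label τ = .dead) : (l.foldl (I.unite S) st).label τ = .dead := by
  induction l generalizing st with
  | nil => exact h
  | cons i l ih =>
    refine ih _ ?_
    obtain ⟨j, b⟩ := τ
    by_cases hj : j = i
    · subst hj
      rw [unite_label_self, if_neg]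
      rintro ⟨h1, h2⟩
      cases b <;> simp_all
    · rw [unite_label_of_ne _ _ _ hj, h]

theorem foldl_kill_dead (I : PCSF V ι) (k : List (ι × Bool)) (st : PDState V ι)
    {τ : ι × Bool} (h : st.label τ = .dead) : (k.foldl I.kill st).label τ = .dead := by
  induction k generalizing st with
  | nil => exact h
  | cons σ k ih =>
    refine ih _ ?_
    rw [kill_label]
    by_cases hσ : τ = σ
    · subst hσ; simp
    · rw [Function.update_of_ne hσ, h]

theorem merge_forest (I : PCSF V ι) (st : PDState V ι) (e : Sym2 V) (S₁ S₂ : Finset V)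
    (l : List ι) : (I.merge st e S₁ S₂ l).forest = insert e st.forest := by
  simp [merge, foldl_unite_forest]

theorem merge_active (I : PCSF V ι) (st : PDState V ι) (e : Sym2 V) (S₁ S₂ : Finset V)
    (l : List ι) :
    (I.merge st e S₁ S₂ l).active = insert (S₁ ∪ S₂) (st.active \ {S₁, S₂}) := by
  simp [merge, foldl_unite_active]

theorem merge_y (I : PCSF V ι) (st : PDState V ι) (e : Sym2 V) (S₁ S₂ : Finset V)
    (l : List ι) : (I.merge st e S₁ S₂ l).y = Function.update st.y (S₁ ∪ S₂) 0 := by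
  simp [merge, foldl_unite_y]

variable [Fintype V]

theorem forest_subset_of_step {I : PCSF V ι} {st st' : PDState V ι} (hs : I.Step st st') :
    st.forest ⊆ st'.forest := by
  cases hs with
  | addEdge Δ hΔ u v huv hne hact htight l hl =>
    rw [merge_forest]
    exact Finset.subset_insert _ _
  | exhaust Δ hΔ S hS hpot l hl =>
    rw [deactivate, foldl_kill_forest]
    rfl

theorem dead_of_step {I : PCSF V ι} {st st' : PDState V ι} (hs : I.Step st st')
    {τ : ι × Bool} (h : st.label τ = .dead) : st'.label τ = .dead := by
  cases hs with
  | addEdge Δ hΔ u v huv hne hact htight l hl =>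
    exact foldl_unite_dead I _ l _ h
  | exhaust Δ hΔ S hS hpot l hl =>
    exact foldl_kill_dead I l _ h

theorem forest_subset_of_reachable {I : PCSF V ι} {st st' : PDState V ι}
    (h : Relation.ReflTransGen I.Step st st') : st.forest ⊆ st'.forest := by
  induction h with
  | refl => rfl
  | tail _ hs ih => exact ih.trans (forest_subset_of_step hs)

theorem dead_of_reachable {I : PCSF V ι} {st st' : PDState V ι}
    (h : Relation.ReflTransGen I.Step st st') {τ : ι × Bool} (hτ : st.label τ = .dead) :
    st'.label τ = .dead := by
  induction h with
  | refl => exact hτ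
  | tail _ hs ih => exact dead_of_step hs ih

theorem sum_load (F : Finset (Sym2 V)) (st : PDState V ι) :
    ∑ e ∈ F, load st e = ∑ S, cutDegree F S * st.y S := by
  simp only [load, cutDegree, Finset.sum_filter]
  rw [Finset.sum_comm]
  refine Finset.sum_congr rfl fun S _ => ?_
  rw [← Finset.sum_filter, Finset.sum_const, nsmul_eq_mul]

/-! ### Termination -/

/-- An upper bound for the number of remaining iterations. -/
def remaining (st : PDState V ι) : ℕ :=
  (Fintype.card (Sym2 V) - st.forest.card) + st.active.card

/-- An added edge is new, and at least one of the merged components was active, so the number of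
active components does not increase. Deactivation lowers that number and keeps the forest. -/
theorem remaining_lt_of_step {I : PCSF V ι} {st st' : PDState V ι} (hs : I.Step st st') :
    remaining st' < remaining st := by
  cases hs with
  | addEdge Δ hΔ u v huv hne hact htight l hl =>
    have he : s(u, v) ∉ st.forest := fun he => hne (component_eq_iff.2 (joined_of_mem he))
    have h1 : (insert s(u, v) st.forest).card ≤ Fintype.card (Sym2 V) := Finset.card_le_univ _
    have h2 : (st.active \ {component st.forest u, component st.forest v}).card <
        st.active.card := by
      refine Finset.card_lt_card (Finset.ssubset_iff_subset_ne.2 ⟨Finset.sdiff_subset, ?_⟩)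
      intro heq
      rcases hact with h | h <;> rw [← heq] at h <;> simp at h
    have h3 := Finset.card_insert_le (component st.forest u ∪ component st.forest v)
      (st.active \ {component st.forest u, component st.forest v})
    unfold remaining
    rw [merge_forest, merge_active]
    simp only [PCSF.grow]
    rw [Finset.card_insert_of_notMem he] at h1 ⊢
    omega
  | exhaust Δ hΔ S hS hpot l hl =>
    have h1 := Finset.card_erase_lt_of_mem hS
    unfold remaining
    rw [deactivate, foldl_kill_forest, foldl_kill_active]
    simp only [PCSF.grow]
    omega

variable [Fintype ι]

/-! ### The edge cost of the output -/

theorem Inv.exists_y_eq {I : PCSF V ι} {st st' : PDState V ι} (h : Inv I st)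
    (hs : I.Step st st') : ∃ Δ, 0 ≤ Δ ∧ st'.y = (PCSF.grow st Δ).y := by
  cases hs with
  | addEdge Δ hΔ u v huv hne hact htight l hl =>
    refine ⟨Δ, hΔ.1, ?_⟩
    rw [merge_y, Function.update_eq_self_iff]
    exact ((h.grow hΔ).ledger.y_union hne).symm
  | exhaust Δ hΔ S hS hpot l hl =>
    refine ⟨Δ, hΔ.1, ?_⟩
    rw [PCSF.deactivate, foldl_kill_y]

theorem Inv.not_diag {I : PCSF V ι} {st : PDState V ι} (h : Inv I st) :
    ∀ e ∈ st.forest, ¬ e.IsDiag := fun _ he =>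
  I.graph.not_isDiag_of_mem_edgeSet (h.forest_sub he)

/-- A pair that is satisfied at the end of the run does not have exactly one terminal in a
component that is inactive at an earlier time. -/
theorem Inv.mem_of_satisfied {I : PCSF V ι} {st stf : PDState V ι} (h : Inv I st)
    (hf : Relation.ReflTransGen I.Step st stf) {S : Finset V} (hS : S ∈ components st.forest)
    (hSa : S ∉ st.active) {i : ι} {b : Bool} (hi : stf.label (i, b) = .satisfied)
    (hb : I.vertex (i, b) ∈ S) : I.vertex (i, !b) ∈ S := by
  obtain ⟨v, rfl⟩ := mem_components.1 hS
  have hsat : st.label (i, b) = .satisfied := by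
    cases hlab : st.label (i, b) with
    | satisfied => rfl
    | dead => rw [dead_of_reachable hf hlab] at hi; exact absurd hi (by simp)
    | alive =>
      have := h.mem_active _ hlab List.not_mem_nil
      rw [component_eq_of_mem hb] at this
      exact absurd this hSa
  have hj : Joined st.forest (I.s i) (I.t i) := not_not.1 (h.satisfied i b hsat).2
  have hj' : Joined st.forest (I.vertex (i, b)) (I.vertex (i, !b)) := by
    cases b
    · exact hj.symm
    · exact hj
  exact mem_component.2 ((mem_component.1 hb).trans hj')

/-- If a single edge of `F` left `S`, a satisfied pair needing that edge would have exactly one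
terminal in `S`, which `Inv.mem_of_satisfied` forbids for an inactive component. -/
theorem Inv.cutDegree_ne_one {I : PCSF V ι} {st stf : PDState V ι} (h : Inv I st)
    (hf : Relation.ReflTransGen I.Step st stf) {F : Finset (Sym2 V)}
    (hc : ConnectsSatisfied I stf F) (hn : EdgesNeeded I stf F) {S : Finset V}
    (hS : S ∈ components st.forest) (hSa : S ∉ st.active) : cutDegree F S ≠ 1 := by
  intro hdeg
  obtain ⟨e, he⟩ := Finset.card_eq_one.1 hdeg
  obtain ⟨heF, heS⟩ := Finset.mem_filter.1 (he ▸ Finset.mem_singleton_self e)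
  have hnc : ∀ e' ∈ F.erase e, ¬ Crosses e' S := by
    intro e' he' hc'
    obtain ⟨h1, h2⟩ := Finset.mem_erase.1 he'
    exact h1 (Finset.mem_singleton.1 (he ▸ Finset.mem_filter.2 ⟨h2, hc'⟩))
  obtain ⟨i, h1, h2, h3⟩ := hn e heF
  have hj := not_not.1 (hc i h1 h2)
  obtain ⟨a, b, rfl, ha, hb⟩ := heS
  rw [← Finset.insert_erase heF] at hj
  rcases joined_insert.1 hj with hj | ⟨hj, hj'⟩ | ⟨hj, hj'⟩
  · exact h3 hj
  · have hs : I.vertex (i, true) ∈ S := (mem_iff_of_joined hnc hj).2 ha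
    have ht : I.vertex (i, false) ∈ S := h.mem_of_satisfied hf hS hSa h1 hs
    exact hb ((mem_iff_of_joined hnc hj').2 ht)
  · have ht : I.vertex (i, false) ∈ S := (mem_iff_of_joined hnc hj').1 ha
    have hs : I.vertex (i, true) ∈ S := h.mem_of_satisfied hf hS hSa h2 ht
    exact hb ((mem_iff_of_joined hnc hj).1 hs)

/-- Induction along the run with the final edge set `F` fixed. Growth by `Δ` adds `Δ` times the
total degree of the active components on the left and `2 * Δ` times their number on the right. -/
theorem sum_load_le_two_mul_sum_y {I : PCSF V ι} {st stf : PDState V ι}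
    (hst : Relation.ReflTransGen I.Step I.initState st)
    (hf : Relation.ReflTransGen I.Step st stf) {F : Finset (Sym2 V)} (hF : F ⊆ stf.forest)
    (hc : ConnectsSatisfied I stf F) (hn : EdgesNeeded I stf F) :
    ∑ e ∈ F, load st e ≤ 2 * ∑ S, st.y S := by
  induction hst with
  | refl =>
    rw [sum_load]
    simp [initState]
  | @tail st st' hst hs ih =>
    have h := inv_of_reachable hst
    have hsf := Relation.ReflTransGen.head hs hf
    have hfin := inv_of_reachable (hst.trans hsf)
    obtain ⟨Δ, hΔ, hy⟩ := h.exists_y_eq hs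
    have hdeg := sum_cutDegree_le (forest_subset_of_reachable hsf) hF hfin.not_diag hfin.acyclic
      (𝒜 := st.active) h.active_sub fun S hS hSa => h.cutDegree_ne_one hsf hc hn hS hSa
    have hgrow : ∀ S, (PCSF.grow st Δ).y S = st.y S + if S ∈ st.active then Δ else 0 := by
      intro S
      simp only [PCSF.grow]
      split_ifs <;> simp
    have ih := ih hsf
    rw [sum_load] at ih ⊢
    simp only [hy, hgrow, mul_add, Finset.sum_add_distrib]
    have e1 : ∑ S, (cutDegree F S : ℝ) * (if S ∈ st.active then Δ else 0) =
        ((∑ S ∈ st.active, cutDegree F S : ℕ) : ℝ) * Δ := by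
      simp only [mul_ite, mul_zero]
      rw [Finset.sum_ite_mem, Finset.univ_inter, Nat.cast_sum, Finset.sum_mul]
    have e2 : ∑ S : Finset V, (if S ∈ st.active then Δ else 0) = st.active.card * Δ := by
      rw [Finset.sum_ite_mem, Finset.univ_inter, Finset.sum_const, nsmul_eq_mul]
    rw [e1, e2, ← mul_assoc]
    refine add_le_add ih (mul_le_mul_of_nonneg_right ?_ hΔ)
    exact_mod_cast hdeg

/-! ### Weak duality -/

theorem Ledger.charge_le_y {I : PCSF V ι} {A : Finset (ι × Bool)} {st : PDState V ι}
    (h : Ledger I A st) (X : Finset ι) (S : Finset V) : ∑ i ∈ X, st.charge i S ≤ st.y S := by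
  rw [h.y_eq]
  refine (Finset.sum_le_sum_of_subset_of_nonneg (Finset.subset_univ X)
    fun i _ _ => h.charge_nonneg i S).trans ?_
  exact le_add_of_nonneg_left (h.uncharged_nonneg S)

theorem Ledger.exists_crosses {I : PCSF V ι} {A : Finset (ι × Bool)} {st : PDState V ι}
    (h : Ledger I A st) {i : ι} {S : Finset V} (hS : st.charge i S ≠ 0) {F : Finset (Sym2 V)}
    (hF : ¬ I.Separated F i) : ∃ e ∈ F, Crosses e S := by
  obtain ⟨b, -, hb⟩ := h.charge_supp i S hS
  obtain ⟨h1, h2, -⟩ := h.mem_of_history i b S hb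
  have hj : Joined F (I.s i) (I.t i) := not_not.1 hF
  refine exists_crosses_of_joined ?_ h1 h2
  cases b
  · exact hj.symm
  · exact hj

/-- Weak duality, set by set: if some pair of `X` charges `S`, then `F` has an edge leaving `S`, so
`y(S)` is counted at least once in the total load of `F`. -/
theorem Inv.sum_charge_le_length {I : PCSF V ι} {st : PDState V ι} (h : Inv I st)
    {F : Finset (Sym2 V)} (hF : (F : Set (Sym2 V)) ⊆ I.graph.edgeSet) {X : Finset ι}
    (hX : ∀ i ∈ X, ¬ I.Separated F i) :
    ∑ i ∈ X, ∑ S, st.charge i S ≤ I.length F := by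
  have h1 : ∑ e ∈ F, load st e ≤ I.length F := Finset.sum_le_sum fun e he => h.load_le e (hF he)
  refine le_trans ?_ h1
  rw [sum_load, Finset.sum_comm]
  refine Finset.sum_le_sum fun S _ => ?_
  have hle := h.ledger.charge_le_y X S
  have hy : 0 ≤ st.y S := by simpa using h.ledger.charge_le_y ∅ S
  by_cases h0 : ∀ i ∈ X, st.charge i S = 0
  · rw [Finset.sum_eq_zero h0]
    positivity
  · push Not at h0
    obtain ⟨i, hi, hne⟩ := h0
    obtain ⟨e, he, hcr⟩ := h.ledger.exists_crosses hne (hX i hi)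
    have hdeg : 1 ≤ cutDegree F S := Finset.card_pos.2 ⟨e, Finset.mem_filter.2 ⟨he, hcr⟩⟩
    have hdeg' : (1 : ℝ) ≤ cutDegree F S := by exact_mod_cast hdeg
    nlinarith

theorem Ledger.sum_charge_le {I : PCSF V ι} {A : Finset (ι × Bool)} {st : PDState V ι}
    (h : Ledger I A st) (i : ι) : ∑ S, st.charge i S ≤ I.penalty i := by
  refine (h.charge_sum_le i).trans ((Finset.sum_le_sum_of_subset_of_nonneg
    (Finset.filter_subset _ _) fun _ _ _ => div_nonneg (I.penalty_nonneg i) zero_le_two).trans ?_)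
  rw [Fintype.sum_bool, add_halves]

theorem Inv.not_alive {I : PCSF V ι} {st : PDState V ι} (h : Inv I st) (hact : st.active = ∅)
    (τ : ι × Bool) : st.label τ ≠ .alive := fun hτ => by
  have := h.mem_active τ hτ List.not_mem_nil
  simp [hact] at this

/-- With no active component no terminal is alive, so `uncharged_sum_le` bounds every uncharged
amount by an empty sum. -/
theorem Inv.y_eq_sum_charge {I : PCSF V ι} {st : PDState V ι} (h : Inv I st)
    (hact : st.active = ∅) (S : Finset V) : st.y S = ∑ i, st.charge i S := by
  rw [h.ledger.y_eq, add_eq_right]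
  by_contra hne
  obtain ⟨v, -, hv⟩ := h.ledger.uncharged_supp S hne
  have hA : aliveSet st = ∅ := by
    rw [Finset.eq_empty_iff_forall_notMem]
    exact fun τ hτ => h.not_alive hact τ (mem_aliveSet.1 hτ)
  have h1 := h.ledger.uncharged_sum_le v S hv
  rw [hA, Finset.filter_empty, Finset.sum_empty] at h1
  have h2 := Finset.single_le_sum (fun T _ => h.ledger.uncharged_nonneg T)
    (Finset.mem_powerset.2 (subset_refl S))
  exact hne (le_antisymm (h2.trans h1) (h.ledger.uncharged_nonneg S))

/-! ### Existence of an output -/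

theorem exists_enumerates {α : Type*} [Fintype α] (p : α → Prop) : ∃ l, Enumerates l p :=
  ⟨(Finset.univ.filter p).toList, Finset.nodup_toList _, by simp⟩

theorem Inv.exists_step {I : PCSF V ι} {st : PDState V ι} (h : Inv I st)
    (hact : st.active.Nonempty) : ∃ st', I.Step st st' := by
  set k : Sym2 V → ℕ := fun e => (st.active.filter (Crosses e ·)).card with hk
  -- The load of `e` grows at rate `k e`, so this quotient is the growth at which `e` becomes tight.
  -- The minimum `Δ` of these quotients and the potentials is the time of the next event.
  set slack : Sym2 V → ℝ := fun e => (I.cost e - load st e) / k e with hslack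
  set Q : Finset ℝ := st.active.image st.potential ∪
    (Finset.univ.filter fun e => e ∈ I.graph.edgeSet ∧ k e ≠ 0).image slack with hQ
  have hQne : Q.Nonempty := (hact.image _).mono Finset.subset_union_left
  set Δ := Q.min' hQne with hΔ
  have hmin : ∀ x ∈ Q, Δ ≤ x := fun x hx => Q.min'_le x hx
  have hgrow : I.CanGrow st Δ := by
    refine ⟨?_, ?_, ?_⟩
    · rw [hΔ, Finset.le_min'_iff]
      intro x hx
      rcases Finset.mem_union.1 hx with hx | hx
      · obtain ⟨S, hS, rfl⟩ := Finset.mem_image.1 hx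
        obtain ⟨v, rfl⟩ := mem_components.1 (h.active_sub S hS)
        exact h.ledger.potential_nonneg v
      · obtain ⟨e, he, rfl⟩ := Finset.mem_image.1 hx
        exact div_nonneg (sub_nonneg.2 (h.load_le e (Finset.mem_filter.1 he).2.1))
          (Nat.cast_nonneg _)
    · exact fun S hS => hmin _ (Finset.mem_union_left _ (Finset.mem_image_of_mem _ hS))
    · intro e he
      rw [load_grow]
      by_cases hke : k e = 0
      · have : (st.active.filter (Crosses e ·)).card = 0 := hke
        rw [this, Nat.cast_zero, zero_mul, add_zero]
        exact h.load_le e he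
      · have h1 := hmin (slack e) (Finset.mem_union_right _ (Finset.mem_image_of_mem _
          (Finset.mem_filter.2 ⟨Finset.mem_univ e, he, hke⟩)))
        rw [hslack, le_div_iff₀ (by positivity)] at h1
        have : Δ * ((st.active.filter (Crosses e ·)).card : ℝ) ≤ I.cost e - load st e := h1
        linarith
  rcases Finset.mem_union.1 (Q.min'_mem hQne) with hx | hx
  · obtain ⟨S, hS, hSΔ⟩ := Finset.mem_image.1 hx
    obtain ⟨l, hl⟩ := exists_enumerates fun τ => I.vertex τ ∈ S ∧ st.label τ = .alive
    refine ⟨_, Step.exhaust st Δ hgrow S hS ?_ l hl⟩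
    simp only [PCSF.grow, if_pos hS]
    rw [hSΔ, hΔ, sub_self]
  · obtain ⟨e, he, heΔ⟩ := Finset.mem_image.1 hx
    obtain ⟨-, he, hke⟩ := Finset.mem_filter.1 he
    have htight : load (PCSF.grow st Δ) e = I.cost e := by
      have hke' : (k e : ℝ) ≠ 0 := by exact_mod_cast hke
      rw [load_grow]
      have h1 : (k e : ℝ) * Δ = I.cost e - load st e := by
        rw [hΔ, ← heΔ]
        exact mul_div_cancel₀ _ hke'
      have h2 : ((st.active.filter (Crosses e ·)).card : ℝ) * Δ = I.cost e - load st e := h1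
      linarith
    obtain ⟨S, hS⟩ := Finset.card_pos.1 (Nat.pos_of_ne_zero hke)
    obtain ⟨hSa, hSc⟩ := Finset.mem_filter.1 hS
    obtain ⟨w, rfl⟩ := mem_components.1 (h.active_sub S hSa)
    obtain ⟨a, b, rfl, ha, hb⟩ := hSc
    obtain ⟨l, hl⟩ := exists_enumerates
      (I.Unites (component st.forest a) (component st.forest b))
    refine ⟨_, Step.addEdge st Δ hgrow a b he ?_ (.inl ?_) htight l hl⟩
    · intro hab
      rw [component_eq_of_mem ha] at hab
      exact hb (hab ▸ self_mem_component _ _)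
    · rwa [component_eq_of_mem ha]

theorem Inv.exists_terminal {I : PCSF V ι} {st : PDState V ι} (h : Inv I st) :
    ∃ st', Relation.ReflTransGen I.Step st st' ∧ st'.active = ∅ := by
  induction hn : remaining st using Nat.strong_induction_on generalizing st with
  | _ n ih =>
    by_cases hact : st.active = ∅
    · exact ⟨st, .refl, hact⟩
    · obtain ⟨st₁, hs⟩ := h.exists_step (Finset.nonempty_iff_ne_empty.2 hact)
      obtain ⟨st₂, h1, h2⟩ := ih _ (hn ▸ remaining_lt_of_step hs) (h.step hs) rfl
      exact ⟨st₂, .head hs h1, h2⟩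

theorem exists_output (I : PCSF V ι) : ∃ F, I.PrimalDualForestOutput F := by
  obtain ⟨st, h1, h2⟩ := (inv_initState I).exists_terminal
  exact ⟨_, st, st.forest.toList, h1, h2, ⟨Finset.nodup_toList _, by simp⟩, rfl⟩

/-! ### The guarantees of the algorithm -/

/-- An output is a forest whose cost is at most twice the sum of a dual solution `z`, in which
`z i` is at most the penalty of the pair `i`, is at least half of it if the output separates the
pair, and in which the pairs connected by any edge set together pay at most its cost. -/
theorem PrimalDualForestOutput.exists_dual {I : PCSF V ι} {F : Finset (Sym2 V)}
    (h : I.PrimalDualForestOutput F) :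
    I.IsForest F ∧ ∃ z : ι → ℝ, I.length F ≤ 2 * ∑ i, z i ∧ (∀ i, z i ≤ I.penalty i) ∧
      (∀ i, I.Separated F i → I.penalty i / 2 ≤ z i) ∧
      ∀ F' : Finset (Sym2 V), (F' : Set (Sym2 V)) ⊆ I.graph.edgeSet → ∀ X : Finset ι,
        (∀ i ∈ X, ¬ I.Separated F' i) → ∑ i ∈ X, z i ≤ I.length F' := by
  obtain ⟨st, l, hst, hact, hl, rfl⟩ := h
  have hinv := inv_of_reachable hst
  have hsub := foldl_deleteEdge_subset I st l st.forest
  have hc : ConnectsSatisfied I st (l.foldl (I.deleteEdge st) st.forest) :=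
    ConnectsSatisfied.foldl_deleteEdge (fun i hi _ => (hinv.satisfied i true hi).2) l
  have hn : EdgesNeeded I st (l.foldl (I.deleteEdge st) st.forest) := fun e he =>
    needed_of_mem_foldl_deleteEdge l _ e ((hl.2 e).2 (hsub he)) he
  refine ⟨⟨?_, ?_⟩, fun i => ∑ S, st.charge i S, ?_, hinv.ledger.sum_charge_le, ?_, ?_⟩
  · exact fun e he => hinv.forest_sub (hsub he)
  · exact hinv.acyclic.anti (SimpleGraph.fromEdgeSet_mono (by exact_mod_cast hsub))
  · have h1 := sum_load_le_two_mul_sum_y hst .refl hsub hc hn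
    have h2 : I.length (l.foldl (I.deleteEdge st) st.forest) =
        ∑ e ∈ l.foldl (I.deleteEdge st) st.forest, load st e :=
      Finset.sum_congr rfl fun e he => (hinv.load_eq e (hsub he)).symm
    rw [h2, Finset.sum_comm]
    simpa only [hinv.y_eq_sum_charge hact] using h1
  · intro i hi
    refine hinv.dead i true ?_
    cases hlab : st.label (i, true) with
    | dead => rfl
    | alive => exact absurd hlab (hinv.not_alive hact _)
    | satisfied => exact absurd hi (hc i hlab (hinv.satisfied i true hlab).1)
  · exact fun F' hF' X hX => hinv.sum_charge_le_length hF' hX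

end PCSF

end

/-! ### The two bounds for the scaled penalties -/

theorem theorem6 {V ι : Type*} [Fintype V] [Fintype ι] (I : PCSF V ι)
    (ε : ℝ) (hε : 0 < ε) (hε1 : ε ≤ 1)
    (Fopt : Finset (Sym2 V)) (hFopt : I.IsOptimal Fopt) :
    (∃ F', (I.scaled ε hε).PrimalDualForestOutput F') ∧
    ∀ F', (I.scaled ε hε).PrimalDualForestOutput F' →
      I.IsForest F' ∧
      ∑ e ∈ F', I.cost e ≤ 8 * I.totalCost Fopt / ε ∧
      ∑ i with (I.Separated F' i ∧ ¬ I.Separated Fopt i), I.penalty i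
        ≤ ε * I.totalCost Fopt := by
  refine ⟨PCSF.exists_output _, fun F' hF' => ?_⟩
  obtain ⟨hforest, z, hcost, hpen, hsep, hdual⟩ := hF'.exists_dual
  have hedge := hFopt.1.1
  have hlen : 0 ≤ I.length Fopt := Finset.sum_nonneg fun e he => I.cost_nonneg e (hedge he)
  have hP : 0 ≤ ∑ i with I.Separated Fopt i, I.penalty i :=
    Finset.sum_nonneg fun i _ => I.penalty_nonneg i
  refine ⟨hforest, ?_, ?_⟩
  · have h1 : ∑ i with ¬ I.Separated Fopt i, z i ≤ I.length Fopt :=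
      hdual Fopt hedge _ fun i hi => (Finset.mem_filter.1 hi).2
    have h2 : ∑ i with I.Separated Fopt i, z i ≤
        2 / ε * ∑ i with I.Separated Fopt i, I.penalty i := by
      rw [Finset.mul_sum]
      refine Finset.sum_le_sum fun i _ => (hpen i).trans_eq ?_
      exact mul_div_right_comm 2 (I.penalty i) ε
    have h3 := Finset.sum_filter_add_sum_filter_not Finset.univ (I.Separated Fopt) z
    have h4 : ∑ e ∈ F', I.cost e ≤ 2 * ∑ i, z i := hcost
    have h5 : (1 : ℝ) ≤ 1 / ε := (one_le_div hε).2 hε1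
    -- The estimates give twice the length plus `2 * (2 / ε)` times the penalties, so the constant
    -- `8` leaves slack: `4` would suffice.
    have h6 : 8 * I.totalCost Fopt / ε = 8 * (1 / ε * I.length Fopt) +
        4 * (2 / ε * ∑ i with I.Separated Fopt i, I.penalty i) := by
      unfold PCSF.totalCost
      ring
    have h7 : 0 ≤ 2 / ε * ∑ i with I.Separated Fopt i, I.penalty i := by positivity
    have h8 : I.length Fopt ≤ 1 / ε * I.length Fopt := le_mul_of_one_le_left hlen h5
    rw [h6]
    linarith
  · have h1 : ∑ i with (I.Separated F' i ∧ ¬ I.Separated Fopt i), z i ≤ I.length Fopt :=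
      hdual Fopt hedge _ fun i hi => (Finset.mem_filter.1 hi).2.2
    have h2 : ∑ i with (I.Separated F' i ∧ ¬ I.Separated Fopt i), I.penalty i ≤
        ε * ∑ i with (I.Separated F' i ∧ ¬ I.Separated Fopt i), z i := by
      rw [Finset.mul_sum]
      refine Finset.sum_le_sum fun i hi => ?_
      -- The factor `2` in the scaled penalty cancels the half that a separated pair is guaranteed
      -- to pay.
      have h3 : 2 * I.penalty i / ε / 2 ≤ z i := hsep i (Finset.mem_filter.1 hi).2.1
      have h4 : 2 * I.penalty i / ε / 2 = I.penalty i / ε := by ring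
      rw [h4, div_le_iff₀ hε] at h3
      linarith
    refine h2.trans (mul_le_mul_of_nonneg_left (h1.trans ?_) hε.le)
    exact le_add_of_nonneg_right hP
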